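/- For groups $G,H$, the wreath product $G\wr H$ is the group of all pairs $(f,x)$ with $x\in H$ and $f:H\to G$ such that $f(z)$ is the identity for all but finitely many $z\in H$, with the product $(f,x)(g,y)=\left(z\mapsto f(z)g(x^{-1}z),\,xy\right)$. Let $\mathbb{Z}_{(1)}=\mathbb{Z}$ and $\mathbb{Z}_{(k+1)}=\mathbb{Z}_{(k)}\wr\mathbb{Z}$ for $k\ge 1$. For a finitely generated group $G$ with a finite symmetric set of generators $S$, let $d$ be the left-invariant word metric induced by $S$, and let $\{W_t\}_{t\ge 0}$ be the simple random walk on the Cayley graph of $G$ determined by $S$, started at the identity $e$ (that is, $W_t=s_1\cdots s_t$ with $s_1,s_2,\dots$ independent and uniformly distributed on $S$). The Hilbert compression exponent $\alpha^*(G)$ is the supremum of all $\alpha\ge 0$ for which there exist a map $f:G\to L_2$ that is $1$-Lipschitz with respect to $d$ and a constant $c>0$ such that $\|f(x)-f(y)\|_2\ge c\,d(x,y)^\alpha$ for all distinct $x,y\in G$. Then for every integer $k\ge 1$ the following hold. 1. $\mathbb{Z}_{(k)}$ has a finite symmetric set of generators for which there are constants $c,\delta>0$ such that, with $\beta=1-2^{-k}$,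 $\Pr\left(d(W_t,e)\ge c\,t^{\beta}\right)\ge\delta$ for all $t\in\mathbb{N}$. 2. For every finite symmetric set of generators of $\mathbb{Z}_{(k)}$ used in the definition of $\alpha^*$, one has $\alpha^*(\mathbb{Z}_{(k)})\le \frac{1}{2-2^{1-k}}$, and in fact $\alpha^*(\mathbb{Z}_{(k)})=\frac{1}{2-2^{1-k}}$. -/

import Mathlib

namespace HilbertCompression

/-- The wreath product of `G` with `H`: the group of all pairs `(f, x)` with `x : H` and
`f : H → G` equal to `1` outside a finite set, with the group law
`(f, x) * (g, y) = (z ↦ f z * g (x⁻¹ * z), x * y)` (inherited from Mathlib's unrestricted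
regular wreath product `G ≀ᵣ H`). -/
def wreathProduct (G H : Type) [Group G] [Group H] : Subgroup (G ≀ᵣ H) where
  carrier := {a | {z : H | a.left z ≠ 1}.Finite}
  one_mem' := by simp
  mul_mem' := by
    intro a b ha hb
    have hb' : ((fun z : H => a.right * z) '' {z : H | b.left z ≠ 1}).Finite := hb.image _
    refine (Set.Finite.union ha hb').subset ?_
    intro z hz
    by_cases h : a.left z = 1
    · right
      refine ⟨a.right⁻¹ * z, ?_, by simp⟩
      intro h'
      exact hz (by simp [h, h'])
    · exact Or.inl h
  inv_mem' := by
    intro a ha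
    have ha' : ((fun z : H => a.right⁻¹ * z) '' {z : H | a.left z ≠ 1}).Finite := ha.image _
    refine ha'.subset ?_
    intro z hz
    refine ⟨a.right * z, ?_, by simp⟩
    intro h'
    exact hz (by simp [h'])

/-- The iterated wreath products `ℤ_(1) = ℤ`, `ℤ_(k+1) = ℤ_(k) ≀ ℤ`, with `ℤ` written
multiplicatively. The value at `0` is a placeholder. -/
def iteratedWreath : ℕ → GrpCat.{0}
  | 0 => GrpCat.of PUnit
  | 1 => GrpCat.of (Multiplicative ℤ)
  | k + 2 => GrpCat.of (wreathProduct (iteratedWreath (k + 1)) (Multiplicative ℤ))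

section

variable {G : Type*} [Group G]

/-- `S` is a finite symmetric set of generators of `G`. -/
def IsSymmGenerating (S : Finset G) : Prop :=
  (∀ s ∈ S, s⁻¹ ∈ S) ∧ Subgroup.closure (S : Set G) = ⊤

/-- The left-invariant word metric induced by the symmetric set of generators `S`:
the least length of a word in `S` representing `x⁻¹ * y`. -/
noncomputable def wordDist (S : Finset G) (x y : G) : ℕ :=
  sInf {n : ℕ | ∃ l : List G, l.length = n ∧ (∀ s ∈ l, s ∈ S) ∧ l.prod = x⁻¹ * y}

/-- `Pr (W_t ∈ A)`, where `W_t` is the simple random walk on the Cayley graph of `G` determined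
by `S`, started at the identity: `W_t = s₁ * ⋯ * s_t` with `s₁, …, s_t` independent and
uniformly distributed on `S`. -/
noncomputable def walkProb (S : Finset G) (t : ℕ) (A : Set G) : ℝ :=
  (Nat.card {w : Fin t → S // (List.ofFn fun i => (w i : G)).prod ∈ A} : ℝ) / (S.card : ℝ) ^ t

/-- There are `c, δ > 0` with `Pr (d (W_t, e) ≥ c * t ^ β) ≥ δ` for all `t`. -/
def HasEscapeEstimate (S : Finset G) (β : ℝ) : Prop :=
  ∃ c δ : ℝ, 0 < c ∧ 0 < δ ∧
    ∀ t : ℕ, δ ≤ walkProb S t {g : G | c * (t : ℝ) ^ β ≤ (wordDist S g 1 : ℝ)}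

/-- The set of all `α ≥ 0` for which there are a `1`-Lipschitz map `f : G → L₂` and `c > 0` with
`‖f x - f y‖ ≥ c * d (x, y) ^ α` for all `x, y`. The lower bound is only asked for when `x ≠ y`;
this matters for `α = 0` alone, where `0 ^ 0 = 1`. -/
def compressionExponents (S : Finset G) : Set ℝ :=
  {α : ℝ | 0 ≤ α ∧ ∃ (f : G → MeasureTheory.Lp ℝ 2 (MeasureTheory.volume : MeasureTheory.Measure ℝ))
    (c : ℝ), 0 < c ∧
      (∀ x y : G, ‖f x - f y‖ ≤ (wordDist S x y : ℝ)) ∧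
      (∀ x y : G, x ≠ y → c * (wordDist S x y : ℝ) ^ α ≤ ‖f x - f y‖)}

/-- The Hilbert compression exponent of `G` (computed with the generators `S`): the supremum of
`compressionExponents S`, taken in `[0, ∞]`. -/
noncomputable def hilbertCompressionExponent (S : Finset G) : ENNReal :=
  ⨆ α ∈ compressionExponents S, ENNReal.ofReal α

end

end HilbertCompression

/-! The two halves of the theorem meet in one induction on `k`: if a random walk on an amenable
group `G` has speed exponent `β` and all exponents in `[1/2, 1/(2β))` are compression exponents of
`G`, then the same is true of `G ≀ ℤ` with `(1 + β)/2` in place of `β`. Starting from `β = 1/2` for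
`ℤ`, this recursion gives `1 - 2^{-k}`. `HasSharpExponents` packages the induction hypothesis.

Upper bound (`IsFolner.mul_le_one`). Hilbert space has Markov type 2: a stationary reversible walk,
seen through a `1`-Lipschitz map, has mean squared displacement at most `t`. Amenability supplies
finite sets on which the walk confined to the set is stationary and, from most points, agrees with
the free walk up to time `t`. Escape at rate `t^β` then forces `t^{2αβ} ≲ t`, so `2αβ ≤ 1`.

Speed (`ZWreath.hasEscapeEstimate_gens`). By time `t` the lamplighter has, on average, of order `√t`
sites at each of which it has made of order `√t` lamp moves. Given its number of moves, a lamp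
performs a random walk on `G`, so with probability bounded below it is at distance of order
`t^{β/2}` from `1`. Word length in `G ≀ ℤ` dominates the sum of the lamp distances, which is of
order `t^{1/2 + β/2}` with positive probability.

Lower bound (`ZWreath.mul_mem_compressionExponents`). Three kinds of Hilbert valued maps are put
together: the position, the lamps mapped by an embedding of `G` with exponent `α`, and for each
direction a weighted record of the configuration ahead of the lamplighter. The last detects the
range `R` of the difference of two elements with size almost `R`. Hölder's inequality over the `2R +
1` lamps gives exponents arbitrarily close to `2α/(2α + 1)`; at `α = 1/(2β)` this is `1/(1 + β)`,
exactly the upper bound for speed `(1 + β)/2`. -/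

namespace HilbertCompression

/-! ### Word metrics of finite symmetric generating sets. -/

section WordMetric

variable {G : Type*} [Group G] {S : Finset G}

theorem IsSymmGenerating.exists_word (hS : IsSymmGenerating S) (g : G) :
    ∃ l : List G, (∀ s ∈ l, s ∈ S) ∧ l.prod = g := by
  have hg : g ∈ Subgroup.closure (S : Set G) := by rw [hS.2]; trivial
  induction hg using Subgroup.closure_induction with
  | mem x hx => exact ⟨[x], by simpa using hx, by simp⟩
  | one => exact ⟨[], by simp, by simp⟩
  | mul x y _ _ hx hy =>
    obtain ⟨l, hl, rfl⟩ := hx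
    obtain ⟨m, hm, rfl⟩ := hy
    refine ⟨l ++ m, ?_, by simp⟩
    intro s hs
    rcases List.mem_append.1 hs with h | h
    exacts [hl s h, hm s h]
  | inv x _ hx =>
    obtain ⟨l, hl, rfl⟩ := hx
    refine ⟨(l.map (·⁻¹)).reverse, ?_, by rw [List.prod_inv_reverse]⟩
    intro s hs
    simp only [List.mem_reverse, List.mem_map] at hs
    obtain ⟨a, ha, rfl⟩ := hs
    exact hS.1 a (hl a ha)

theorem wordDist_eq_one_left (S : Finset G) (x y : G) :
    wordDist S x y = wordDist S 1 (x⁻¹ * y) := by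
  simp [wordDist]

theorem wordDist_le_length (l : List G) (hl : ∀ s ∈ l, s ∈ S) :
    wordDist S 1 l.prod ≤ l.length :=
  Nat.sInf_le ⟨l, rfl, hl, by simp⟩

theorem wordDist_self (S : Finset G) (x : G) : wordDist S x x = 0 := by
  rw [wordDist_eq_one_left]
  simpa using wordDist_le_length (S := S) [] (by simp)

theorem wordDist_one_le_one {s : G} (hs : s ∈ S) : wordDist S 1 s ≤ 1 := by
  simpa using wordDist_le_length (S := S) [s] (by simpa using hs)

theorem IsSymmGenerating.exists_word_length (hS : IsSymmGenerating S) (g : G) :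
    ∃ l : List G, l.length = wordDist S 1 g ∧ (∀ s ∈ l, s ∈ S) ∧ l.prod = g := by
  obtain ⟨l, hl, hg⟩ := hS.exists_word g
  have := Nat.sInf_mem (s := {n : ℕ | ∃ l : List G, l.length = n ∧ (∀ s ∈ l, s ∈ S) ∧
    l.prod = 1⁻¹ * g}) ⟨_, l, rfl, hl, by simpa using hg⟩
  obtain ⟨m, h1, h2, h3⟩ := this
  exact ⟨m, h1, h2, by simpa using h3⟩

theorem IsSymmGenerating.wordDist_one_mul_le (hS : IsSymmGenerating S) (g h : G) :
    wordDist S 1 (g * h) ≤ wordDist S 1 g + wordDist S 1 h := by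
  obtain ⟨l, hl, hl', rfl⟩ := hS.exists_word_length g
  obtain ⟨m, hm, hm', rfl⟩ := hS.exists_word_length h
  rw [← hl, ← hm, ← List.prod_append, ← List.length_append]
  refine wordDist_le_length _ ?_
  intro s hs
  rcases List.mem_append.1 hs with h | h
  exacts [hl' s h, hm' s h]

theorem IsSymmGenerating.wordDist_one_inv_le (hS : IsSymmGenerating S) (g : G) :
    wordDist S 1 g⁻¹ ≤ wordDist S 1 g := by
  obtain ⟨l, hl, hl', rfl⟩ := hS.exists_word_length g
  rw [← hl, List.prod_inv_reverse]
  refine (wordDist_le_length _ ?_).trans (by simp)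
  intro s hs
  simp only [List.mem_reverse, List.mem_map] at hs
  obtain ⟨a, ha, rfl⟩ := hs
  exact hS.1 a (hl' a ha)

theorem IsSymmGenerating.wordDist_one_inv (hS : IsSymmGenerating S) (g : G) :
    wordDist S 1 g⁻¹ = wordDist S 1 g :=
  le_antisymm (hS.wordDist_one_inv_le g) (by simpa using hS.wordDist_one_inv_le g⁻¹)

theorem IsSymmGenerating.wordDist_one_right (hS : IsSymmGenerating S) (g : G) :
    wordDist S g 1 = wordDist S 1 g := by
  rw [wordDist_eq_one_left, mul_one, hS.wordDist_one_inv]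

theorem IsSymmGenerating.wordDist_pos (hS : IsSymmGenerating S) {x y : G} (h : x ≠ y) :
    0 < wordDist S x y := by
  rw [wordDist_eq_one_left, Nat.pos_iff_ne_zero]
  intro h0
  obtain ⟨l, hl, -, hp⟩ := hS.exists_word_length (x⁻¹ * y)
  rw [h0, List.length_eq_zero_iff] at hl
  subst hl
  exact h (inv_mul_eq_one.1 (by simpa using hp.symm))

/-- The tool for bounding word length from below: exhibit a quantity that each generator increases
by at most one. -/
theorem IsSymmGenerating.le_wordDist_one (hS : IsSymmGenerating S) (φ : G → ℕ) (h1 : φ 1 = 0)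
    (h : ∀ g, ∀ s ∈ S, φ (g * s) ≤ φ g + 1) (g : G) : φ g ≤ wordDist S 1 g := by
  obtain ⟨l, hl, hl', rfl⟩ := hS.exists_word_length g
  rw [← hl]
  clear hl
  induction l using List.reverseRecOn with
  | nil => simp [h1]
  | append_singleton l a ih =>
    have := h l.prod a (hl' a (by simp))
    have ih' := ih (fun s hs => hl' s (by simp [hs]))
    simp only [List.prod_append, List.prod_singleton, List.length_append, List.length_singleton]
    omega

theorem IsSymmGenerating.norm_sub_le (hS : IsSymmGenerating S) {E : Type*}
    [SeminormedAddCommGroup E] (f : G → E) (C : ℝ)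
    (h : ∀ g, ∀ s ∈ S, ‖f g - f (g * s)‖ ≤ C) (x y : G) :
    ‖f x - f y‖ ≤ C * wordDist S x y := by
  obtain ⟨l, hl, hl', hp⟩ := hS.exists_word_length (x⁻¹ * y)
  obtain rfl : y = x * l.prod := by rw [hp]; group
  rw [wordDist_eq_one_left, ← hl]
  clear hl hp
  induction l using List.reverseRecOn with
  | nil => simp
  | append_singleton l a ih =>
    have h2 := h (x * l.prod) a (hl' a (by simp))
    have ih' := ih (fun s hs => hl' s (by simp [hs]))
    simp only [List.prod_append, List.prod_singleton, List.length_append, List.length_singleton]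
    rw [← mul_assoc]
    push_cast
    linarith [norm_sub_le_norm_sub_add_norm_sub (f x) (f (x * l.prod)) (f (x * l.prod * a))]

theorem IsSymmGenerating.countable (hS : IsSymmGenerating S) : Countable G := by
  have : Function.Surjective (fun l : List S => (l.map (↑)).prod : List S → G) := by
    intro g
    obtain ⟨l, hl, rfl⟩ := hS.exists_word g
    lift l to List S using hl
    exact ⟨l, rfl⟩
  exact this.countable

theorem IsSymmGenerating.exists_wordDist_le_mul (hS : IsSymmGenerating S) (T : Finset G) :
    ∃ C : ℕ, 0 < C ∧ ∀ l : List G, (∀ s ∈ l, s ∈ T) → wordDist S 1 l.prod ≤ C * l.length := by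
  refine ⟨T.sup (wordDist S 1) + 1, by omega, ?_⟩
  intro l hl
  induction l with
  | nil => simp [wordDist_self]
  | cons a l ih =>
    have h1 := hS.wordDist_one_mul_le a l.prod
    have h2 := ih (fun s hs => hl s (by simp [hs]))
    have h3 : wordDist S 1 a ≤ T.sup (wordDist S 1) := Finset.le_sup (hl a (by simp))
    simp only [List.prod_cons, List.length_cons]
    nlinarith

/-- Word metrics of finite generating sets are bi-Lipschitz equivalent. -/
theorem IsSymmGenerating.exists_wordDist_le (hS : IsSymmGenerating S) {T : Finset G}
    (hT : IsSymmGenerating T) :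
    ∃ C : ℕ, 0 < C ∧ ∀ x y, wordDist S x y ≤ C * wordDist T x y := by
  obtain ⟨C, hC, h⟩ := hS.exists_wordDist_le_mul T
  refine ⟨C, hC, fun x y => ?_⟩
  obtain ⟨l, hl, hl', hp⟩ := hT.exists_word_length (x⁻¹ * y)
  rw [wordDist_eq_one_left S, wordDist_eq_one_left T, ← hl, ← hp]
  exact h l hl'

theorem finite_wordBall (hS : IsSymmGenerating S) (t : ℕ) : {g : G | wordDist S 1 g ≤ t}.Finite := by
  have hfin : {l : List S | l.length ≤ t}.Finite := List.finite_length_le S t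
  refine (hfin.image fun l => (l.map (↑)).prod).subset ?_
  intro g hg
  obtain ⟨l, hl, hl', rfl⟩ := hS.exists_word_length g
  have hlt : l.length ≤ t := hl.le.trans hg
  lift l to List S using hl'
  exact ⟨l, by simpa using hlt, rfl⟩

end WordMetric

end HilbertCompression

namespace HilbertCompression

open MeasureTheory

/-! ### Assembling Hilbert space valued maps and realizing them in `L₂`. -/

section Hilbert

/-- The indicators of the intervals `[n, n + 1)`, as an orthonormal sequence in `L₂`. -/
noncomputable def unitIndicator (n : ℕ) : Lp ℝ 2 (volume : Measure ℝ) :=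
  indicatorConstLp 2 (measurableSet_Ico (a := (n : ℝ)) (b := n + 1)) (by simp) (1 : ℝ)

theorem orthonormal_unitIndicator : Orthonormal ℝ unitIndicator := by
  classical
  rw [orthonormal_iff_ite]
  intro i j
  rw [unitIndicator, unitIndicator, L2.real_inner_indicatorConstLp_one_indicatorConstLp_one
    (hμs := by simp) (hμt := by simp)]
  split_ifs with h
  · subst h
    simp
  · have : Set.Ico (i : ℝ) (i + 1) ∩ Set.Ico (j : ℝ) (j + 1) = ∅ := by
      ext x
      simp only [Set.mem_inter_iff, Set.mem_Ico, Set.mem_empty_iff_false, iff_false]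
      rintro ⟨⟨h1, h2⟩, h3, h4⟩
      apply h
      have h5 : (i : ℝ) < j + 1 := h1.trans_lt h4
      have h6 : (j : ℝ) < i + 1 := h3.trans_lt h2
      norm_cast at h5 h6
      omega
    simp [this]

/-- Orthonormal vectors are `√2` apart, so the balls of radius `1/2` around them are disjoint open
sets of a separable space. -/
theorem countable_of_orthonormal {ι E : Type*} [NormedAddCommGroup E] [InnerProductSpace ℝ E]
    [TopologicalSpace.SeparableSpace E] {v : ι → E} (hv : Orthonormal ℝ v) : Countable ι := by
  have hd : Pairwise (Function.onFun Disjoint fun i => Metric.ball (v i) (1 / 2)) := by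
    intro i j hij
    apply Metric.ball_disjoint_ball
    have h : ‖v i - v j‖ ^ 2 = 2 := by
      rw [norm_sub_sq_real, hv.1, hv.1, hv.2 hij]
      norm_num
    rw [dist_eq_norm]
    nlinarith [norm_nonneg (v i - v j)]
  rw [← Set.countable_univ_iff]
  exact Set.PairwiseDisjoint.countable_of_isOpen (fun i _ j _ hij => hd hij)
    (fun i _ => Metric.isOpen_ball) (fun i _ => ⟨v i, by simp⟩)

/-- A countable subset of a Hilbert space embeds isometrically into `L₂`. -/
theorem exists_isometric_map_L2 {X E : Type*} [Countable X] [NormedAddCommGroup E]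
    [InnerProductSpace ℝ E] [CompleteSpace E] (F : X → E) :
    ∃ F' : X → Lp ℝ 2 (volume : Measure ℝ), ∀ x y, ‖F' x - F' y‖ = ‖F x - F y‖ := by
  -- The closed span of a countable set is separable, so it has a countable Hilbert basis, which can
  -- be sent to distinct `unitIndicator`s.
  let K : Submodule ℝ E := (Submodule.span ℝ (Set.range F)).topologicalClosure
  have hK : TopologicalSpace.IsSeparable (K : Set E) := by
    rw [Submodule.topologicalClosure_coe]
    exact ((Set.countable_range F).isSeparable.span).closure
  have : TopologicalSpace.SeparableSpace K := hK.separableSpace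
  have : CompleteSpace K := Submodule.isClosed_topologicalClosure _ |>.completeSpace_coe
  obtain ⟨w, b, -⟩ := exists_hilbertBasis ℝ K
  have hw : Countable w := countable_of_orthonormal b.orthonormal
  obtain ⟨e, he⟩ := exists_injective_nat w
  have ho := (orthonormal_unitIndicator.comp e he).orthogonalFamily
  refine ⟨fun x => ho.linearIsometry (b.repr ⟨F x, ?_⟩), fun x y => ?_⟩
  · exact Submodule.le_topologicalClosure _ (Submodule.subset_span ⟨x, rfl⟩)
  · rw [← map_sub, LinearIsometry.norm_map, ← map_sub, LinearIsometryEquiv.norm_map]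
    rfl

/-- A family of maps into Hilbert spaces with square summable differences combines to a single
map into the Hilbert sum. -/
theorem exists_map_lp {X ι : Type*} {E : ι → Type*} [∀ i, NormedAddCommGroup (E i)]
    (F : ∀ i, X → E i) (h : ∀ x y, Summable fun i => ‖F i x - F i y‖ ^ 2) :
    ∃ Φ : X → lp E 2, ∀ x y, ‖Φ x - Φ y‖ ^ 2 = ∑' i, ‖F i x - F i y‖ ^ 2 := by
  rcases isEmpty_or_nonempty X with hX | ⟨⟨o⟩⟩
  · exact ⟨fun x => (hX.false x).elim, fun x => (hX.false x).elim⟩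
  -- The individual families need not be square summable; subtracting the value at a base point
  -- makes them so and cancels in differences.
  have hm : ∀ x, Memℓp (fun i => F i x - F i o) 2 := fun x => by
    rw [memℓp_gen_iff (by norm_num)]
    simpa using h x o
  refine ⟨fun x => ⟨_, hm x⟩, fun x y => ?_⟩
  have := lp.norm_rpow_eq_tsum (p := 2) (E := E) (by norm_num)
    ((⟨_, hm x⟩ : lp E 2) - ⟨_, hm y⟩)
  simp only [ENNReal.toReal_ofNat, Real.rpow_ofNat] at this
  rw [this]
  congr 1
  ext i
  congr 2
  simp only [AddSubgroupClass.coe_sub]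
  exact sub_sub_sub_cancel_right _ _ _

variable {G : Type*} [Group G] {S : Finset G}

/-- Summability propagates along a word by `(a + b)² ≤ 2a² + 2b²`; the growing constants do not
matter since only finiteness is claimed. -/
theorem IsSymmGenerating.summable_norm_sub_sq (hS : IsSymmGenerating S) {ι : Type*} {E : ι → Type*}
    [∀ i, NormedAddCommGroup (E i)] (F : ∀ i, G → E i)
    (h : ∀ x, ∀ s ∈ S, Summable fun i => ‖F i x - F i (x * s)‖ ^ 2) (x y : G) :
    Summable fun i => ‖F i x - F i y‖ ^ 2 := by
  obtain ⟨l, hl', hp⟩ := hS.exists_word (x⁻¹ * y)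
  obtain rfl : y = x * l.prod := by rw [hp]; group
  clear hp
  induction l using List.reverseRecOn with
  | nil => simp
  | append_singleton l a ih =>
    have h2 := h (x * l.prod) a (hl' a (by simp))
    have ih' := ih (fun s hs => hl' s (by simp [hs]))
    refine Summable.of_nonneg_of_le (fun _ => sq_nonneg _) (fun i => ?_)
      ((ih'.mul_left 2).add (h2.mul_left 2))
    simp only [List.prod_append, List.prod_singleton]
    rw [← mul_assoc]
    have := norm_sub_le_norm_sub_add_norm_sub (F i x) (F i (x * l.prod)) (F i (x * l.prod * a))
    nlinarith [norm_nonneg (F i x - F i (x * l.prod * a)),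
      sq_nonneg (‖F i x - F i (x * l.prod)‖ - ‖F i (x * l.prod) - F i (x * l.prod * a)‖)]

/-- Families of Hilbert space valued maps that are Lipschitz along the generators. -/
theorem IsSymmGenerating.exists_map_lp (hS : IsSymmGenerating S) {ι : Type*} {E : ι → Type*}
    [∀ i, NormedAddCommGroup (E i)] (F : ∀ i, G → E i) (C : ℝ)
    (h : ∀ x, ∀ s ∈ S, Summable (fun i => ‖F i x - F i (x * s)‖ ^ 2) ∧
      ∑' i, ‖F i x - F i (x * s)‖ ^ 2 ≤ C) :
    ∃ Φ : G → lp E 2, (∀ x, ∀ s ∈ S, ‖Φ x - Φ (x * s)‖ ^ 2 ≤ C) ∧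
      ∀ x y, ∀ s : Finset ι, ∑ i ∈ s, ‖F i x - F i y‖ ^ 2 ≤ ‖Φ x - Φ y‖ ^ 2 := by
  have hs := hS.summable_norm_sub_sq F (fun x s hs => (h x s hs).1)
  obtain ⟨Φ, hΦ⟩ := HilbertCompression.exists_map_lp F hs
  refine ⟨Φ, fun x s hs => (hΦ _ _).trans_le (h x s hs).2, fun x y s => ?_⟩
  rw [hΦ]
  exact (hs x y).sum_le_tsum s (fun _ _ => sq_nonneg _)

/-- Any coarse lower bound `c * d ^ α ≤ ‖Φ x - Φ y‖` for a Hilbert space valued map that is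
Lipschitz along some generating set shows that `α` is a compression exponent. -/
theorem IsSymmGenerating.mem_compressionExponents (hS : IsSymmGenerating S) {T : Finset G}
    (hT : IsSymmGenerating T) {E : Type*} [NormedAddCommGroup E]
    [InnerProductSpace ℝ E] [CompleteSpace E] (Φ : G → E) {C c α : ℝ} (hα : 0 ≤ α)
    (hC : ∀ x, ∀ s ∈ T, ‖Φ x - Φ (x * s)‖ ≤ C) (hc : 0 < c)
    (hl : ∀ x y, x ≠ y → c * (wordDist T x y : ℝ) ^ α ≤ ‖Φ x - Φ y‖) :
    α ∈ compressionExponents S := by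
  have := hS.countable
  obtain ⟨F, hF⟩ := exists_isometric_map_L2 Φ
  obtain ⟨A, hA, hTS⟩ := hT.exists_wordDist_le hS
  obtain ⟨B, hB, hST⟩ := hS.exists_wordDist_le hT
  set C' : ℝ := max C 1
  have hC' : 0 < C' := lt_max_of_lt_right one_pos
  have hA' : (0 : ℝ) < A := by exact_mod_cast hA
  have hB' : (0 : ℝ) < B := by exact_mod_cast hB
  have hCA : 0 < (C' * A)⁻¹ := by positivity
  refine ⟨hα, fun x => (C' * A)⁻¹ • F x, (C' * A)⁻¹ * (c * ((B : ℝ)⁻¹) ^ α), by positivity,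
    fun x y => ?_, fun x y hxy => ?_⟩
  · rw [← smul_sub, norm_smul, Real.norm_of_nonneg hCA.le, hF, inv_mul_le_iff₀ (by positivity)]
    have h1 := hT.norm_sub_le Φ C' (fun g s hs => (hC g s hs).trans (le_max_left _ _)) x y
    have h2 : (wordDist T x y : ℝ) ≤ A * wordDist S x y := by exact_mod_cast hTS x y
    calc _ ≤ _ := h1
      _ ≤ _ := by rw [mul_assoc]; gcongr
  · rw [← smul_sub, norm_smul, Real.norm_of_nonneg hCA.le, hF, mul_assoc]
    gcongr
    refine le_trans ?_ (hl x y hxy)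
    rw [mul_assoc, ← Real.mul_rpow (by positivity) (by positivity)]
    have h2 : (wordDist S x y : ℝ) ≤ B * wordDist T x y := by exact_mod_cast hST x y
    gcongr
    rwa [inv_mul_le_iff₀ hB']

/-- Compression exponents do not depend on the generating set. -/
theorem compressionExponents_eq (hS : IsSymmGenerating S) {T : Finset G}
    (hT : IsSymmGenerating T) : compressionExponents S = compressionExponents T := by
  have key : ∀ {S T : Finset G}, IsSymmGenerating S → IsSymmGenerating T →
      compressionExponents T ⊆ compressionExponents S := by
    rintro S T hS hT α ⟨hα, f, c, hc, h1, h2⟩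
    refine hS.mem_compressionExponents hT f (C := 1) hα (fun x s hs => (h1 _ _).trans ?_) hc h2
    rw [wordDist_eq_one_left]
    exact_mod_cast wordDist_one_le_one (by simpa using hs)
  exact (key hT hS).antisymm (key hS hT)

end Hilbert

end HilbertCompression

namespace HilbertCompression

/-! ### Expectations over uniformly random words. -/

section WordAvg

/-- The average of `F` over all words of length `t` in the finite alphabet `A`. -/
noncomputable def wordAvg (A : Type*) [Fintype A] : ℕ → (List A → ℝ) → ℝ
  | 0, F => F []
  | t + 1, F => (∑ a : A, wordAvg A t fun l => F (a :: l)) / Fintype.card A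

variable {A : Type*} [Fintype A]

@[simp]
theorem wordAvg_zero (F : List A → ℝ) : wordAvg A 0 F = F [] := rfl

theorem wordAvg_succ (t : ℕ) (F : List A → ℝ) :
    wordAvg A (t + 1) F = (∑ a : A, wordAvg A t fun l => F (a :: l)) / Fintype.card A := rfl

/-- The recursive form serves conditioning on the first letter; this closed form yields linearity,
monotonicity and Cauchy-Schwarz. -/
theorem wordAvg_eq_sum (t : ℕ) (F : List A → ℝ) :
    wordAvg A t F = (∑ w : Fin t → A, F (List.ofFn w)) / (Fintype.card A : ℝ) ^ t := by
  induction t generalizing F with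
  | zero => simp
  | succ t ih =>
    rw [wordAvg_succ, ← (Fin.consEquiv fun _ => A).sum_comp, Fintype.sum_prod_type]
    simp only [ih, ← Finset.sum_div, div_div, ← pow_succ]
    simp [Fin.consEquiv, List.ofFn_succ]

theorem wordAvg_mono {t : ℕ} {F F' : List A → ℝ} (h : ∀ l, l.length = t → F l ≤ F' l) :
    wordAvg A t F ≤ wordAvg A t F' := by
  rw [wordAvg_eq_sum, wordAvg_eq_sum]
  gcongr
  exact h _ (by simp)

theorem wordAvg_const [Nonempty A] (t : ℕ) (c : ℝ) : wordAvg A t (fun _ => c) = c := by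
  rw [wordAvg_eq_sum]
  simp

theorem wordAvg_add (t : ℕ) (F F' : List A → ℝ) :
    wordAvg A t (fun l => F l + F' l) = wordAvg A t F + wordAvg A t F' := by
  simp only [wordAvg_eq_sum, Finset.sum_add_distrib, add_div]

theorem wordAvg_sub (t : ℕ) (F F' : List A → ℝ) :
    wordAvg A t (fun l => F l - F' l) = wordAvg A t F - wordAvg A t F' := by
  simp only [wordAvg_eq_sum, Finset.sum_sub_distrib, sub_div]

theorem wordAvg_mul_left (t : ℕ) (c : ℝ) (F : List A → ℝ) :
    wordAvg A t (fun l => c * F l) = c * wordAvg A t F := by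
  simp only [wordAvg_eq_sum, ← Finset.mul_sum, mul_div_assoc]

theorem wordAvg_div (t : ℕ) (F : List A → ℝ) (c : ℝ) :
    wordAvg A t (fun l => F l / c) = wordAvg A t F / c := by
  simp only [div_eq_inv_mul, wordAvg_mul_left]

theorem wordAvg_sum {ι : Type*} (s : Finset ι) (t : ℕ) (F : ι → List A → ℝ) :
    wordAvg A t (fun l => ∑ i ∈ s, F i l) = ∑ i ∈ s, wordAvg A t (F i) := by
  simp only [wordAvg_eq_sum]
  rw [Finset.sum_comm, Finset.sum_div]

/-- The Cauchy-Schwarz inequality for word averages. -/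
theorem wordAvg_mul_sq_le (t : ℕ) (F F' : List A → ℝ) :
    wordAvg A t (fun l => F l * F' l) ^ 2 ≤
      wordAvg A t (fun l => F l ^ 2) * wordAvg A t (fun l => F' l ^ 2) := by
  simp only [wordAvg_eq_sum]
  rw [div_pow, div_mul_div_comm, ← sq]
  gcongr
  exact Finset.sum_mul_sq_le_sq_mul_sq _ _ _

theorem wordAvg_sq_le [Nonempty A] (t : ℕ) (F : List A → ℝ) :
    wordAvg A t F ^ 2 ≤ wordAvg A t (fun l => F l ^ 2) := by
  simpa [wordAvg_const] using wordAvg_mul_sq_le t F (fun _ => 1)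

theorem wordAvg_map_equiv {B : Type*} [Fintype B] (e : A ≃ B) (t : ℕ) (F : List B → ℝ) :
    wordAvg A t (fun l => F (l.map e)) = wordAvg B t F := by
  induction t generalizing F with
  | zero => simp
  | succ t ih =>
    rw [wordAvg_succ, wordAvg_succ, Fintype.card_congr e, ← e.sum_comp]
    simp only [List.map_cons]
    congr 1
    exact Finset.sum_congr rfl fun a _ => ih (fun l => F (e a :: l))

open Classical in
theorem walkProb_eq_wordAvg {G : Type*} [Group G] (S : Finset G) (t : ℕ) (E : Set G) :
    walkProb S t E = wordAvg S t (fun l => if (l.map (↑)).prod ∈ E then 1 else 0) := by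
  rw [walkProb, wordAvg_eq_sum, Fintype.card_coe]
  congr 1
  rw [Finset.sum_boole, Nat.card_eq_fintype_card, Fintype.card_subtype]
  congr 2
  ext w
  simp [List.map_ofFn, Function.comp_def]

open Classical in
/-- A bounded function with large average is large with positive probability. -/
theorem le_wordAvg_indicator [Nonempty A] (t : ℕ) (F : List A → ℝ) {a b : ℝ} (hb : 0 < b)
    (hF : ∀ l, l.length = t → F l ≤ b) (ha : 2 * a ≤ wordAvg A t F) (ha0 : 0 ≤ a) :
    a / b ≤ wordAvg A t (fun l => if a ≤ F l then 1 else 0) := by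
  -- Pointwise, `F` is at most `b` on the event and at most `a` off it.
  have h : wordAvg A t F ≤ wordAvg A t (fun l => b * (if a ≤ F l then 1 else 0) + a) := by
    refine wordAvg_mono fun l hl => ?_
    split_ifs with h
    · linarith [hF l hl]
    · linarith
  rw [wordAvg_add, wordAvg_mul_left, wordAvg_const] at h
  rw [div_le_iff₀ hb]
  linarith

end WordAvg

end HilbertCompression

namespace HilbertCompression

/-! ### Markov type 2 of Hilbert space for the walk confined to a finite set. -/

section MarkovType

open Classical RealInnerProductSpace

variable {G : Type*} [Group G]

/-- One step of the walk confined to the finite set `F`: a step leaving `F` is suppressed. -/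
noncomputable def confinedStep (F : Finset G) (x s : G) : G := if x * s ∈ F then x * s else x

variable {S F : Finset G}

/-- Reversibility of the confined walk. -/
theorem sum_confinedStep_comm (hS : ∀ s ∈ S, s⁻¹ ∈ S) {M : Type*} [AddCommMonoid M]
    (φ : G → G → M) :
    ∑ x ∈ F, ∑ s : S, φ x (confinedStep F x s) = ∑ x ∈ F, ∑ s : S, φ (confinedStep F x s) x := by
  rw [← Finset.sum_product', ← Finset.sum_product']
  -- The involution reverses every step `(x, s)` that stays in `F` to `(xs, s⁻¹)` and fixes the
  -- suppressed steps.
  refine Finset.sum_nbij' (fun p => if p.1 * p.2 ∈ F then (p.1 * p.2, ⟨p.2⁻¹, hS _ p.2.2⟩) else p)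
    (fun p => if p.1 * p.2 ∈ F then (p.1 * p.2, ⟨p.2⁻¹, hS _ p.2.2⟩) else p) ?_ ?_ ?_ ?_ ?_
  · rintro ⟨x, s⟩ h
    simp only [Finset.mem_product, Finset.mem_univ, and_true] at h ⊢
    split_ifs with h'
    exacts [h', h]
  · rintro ⟨x, s⟩ h
    simp only [Finset.mem_product, Finset.mem_univ, and_true] at h ⊢
    split_ifs with h'
    exacts [h', h]
  · rintro ⟨x, s⟩ h
    simp only [Finset.mem_product, Finset.mem_univ, and_true] at h ⊢
    by_cases h' : x * s ∈ F <;> simp [h', h]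
  · rintro ⟨x, s⟩ h
    simp only [Finset.mem_product, Finset.mem_univ, and_true] at h ⊢
    by_cases h' : x * s ∈ F <;> simp [h', h]
  · rintro ⟨x, s⟩ h
    simp only [Finset.mem_product, Finset.mem_univ, and_true] at h
    by_cases h' : x * s ∈ F <;> simp [h', h, confinedStep]

variable {E : Type*} [NormedAddCommGroup E] [InnerProductSpace ℝ E]

/-- The Markov operator of the confined walk. -/
noncomputable def markovOp (S F : Finset G) (u : G → E) (x : G) : E :=
  (Fintype.card S : ℝ)⁻¹ • ∑ s : S, u (confinedStep F x s)

/-- The inner product of vector valued functions on `F`. -/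
noncomputable def sumInner (F : Finset G) (u v : G → E) : ℝ := ∑ x ∈ F, ⟪u x, v x⟫

theorem sumInner_comm {X : Type*} {F : Finset X} (u v : X → E) : sumInner F u v = sumInner F v u :=
  Finset.sum_congr rfl fun _ _ => real_inner_comm _ _

theorem sumInner_sub_left {X : Type*} {F : Finset X} (u v w : X → E) :
    sumInner F (u - v) w = sumInner F u w - sumInner F v w := by
  simp [sumInner, inner_sub_left, Finset.sum_sub_distrib]

theorem sumInner_sub_right {X : Type*} {F : Finset X} (u v w : X → E) :
    sumInner F w (u - v) = sumInner F w u - sumInner F w v := by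
  simp [sumInner, inner_sub_right, Finset.sum_sub_distrib]

theorem markovOp_sub (u v : G → E) : markovOp S F (u - v) = markovOp S F u - markovOp S F v := by
  ext x
  simp [markovOp, Finset.sum_sub_distrib, smul_sub]

theorem sumInner_markovOp (u v : G → E) : sumInner F (markovOp S F u) v =
    (Fintype.card S : ℝ)⁻¹ * ∑ x ∈ F, ∑ s : S, ⟪u (confinedStep F x s), v x⟫ := by
  simp [sumInner, markovOp, inner_smul_left, sum_inner, Finset.mul_sum]

theorem sumInner_markovOp_comm (hS : ∀ s ∈ S, s⁻¹ ∈ S) (u v : G → E) :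
    sumInner F (markovOp S F u) v = sumInner F u (markovOp S F v) := by
  rw [sumInner_comm u, sumInner_markovOp, sumInner_markovOp,
    sum_confinedStep_comm hS (fun x y => ⟪v y, u x⟫)]
  simp only [real_inner_comm]

/-- Reversibility makes the uniform measure on `F` stationary. -/
theorem sum_norm_sq_confinedStep (hS : ∀ s ∈ S, s⁻¹ ∈ S) (hne : S.Nonempty) (φ : G → ℝ) :
    (Fintype.card S : ℝ)⁻¹ * ∑ x ∈ F, ∑ s : S, φ (confinedStep F x s) = ∑ x ∈ F, φ x := by
  have h0 : (S.card : ℝ) ≠ 0 := by exact_mod_cast hne.card_pos.ne'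
  rw [sum_confinedStep_comm hS (fun _ y => φ y)]
  simp only [Finset.sum_const, ← Finset.smul_sum, Finset.card_univ, Fintype.card_coe]
  rw [nsmul_eq_mul, inv_mul_cancel_left₀ h0]

theorem sumInner_self {X : Type*} {F : Finset X} (u : X → E) : sumInner F u u = ∑ x ∈ F, ‖u x‖ ^ 2 := by
  simp [sumInner]

/-- Expand the square; by stationarity both square terms give `⟨u, u⟩`. This identifies the mean
squared one-step increment with the Dirichlet form `⟨(1 - P)u, u⟩` of the Markov operator `P`. -/
theorem sum_norm_sub_sq_confinedStep (hS : ∀ s ∈ S, s⁻¹ ∈ S) (hne : S.Nonempty) (u : G → E) :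
    (Fintype.card S : ℝ)⁻¹ * ∑ x ∈ F, ∑ s : S, ‖u x - u (confinedStep F x s)‖ ^ 2 =
      2 * sumInner F (u - markovOp S F u) u := by
  have h0 : (S.card : ℝ) ≠ 0 := by exact_mod_cast hne.card_pos.ne'
  have h1 := sum_norm_sq_confinedStep (F := F) hS hne (fun x => ‖u x‖ ^ 2)
  have h2 : sumInner F (markovOp S F u) u =
      (Fintype.card S : ℝ)⁻¹ * ∑ x ∈ F, ∑ s : S, ⟪u x, u (confinedStep F x s)⟫ := by
    rw [sumInner_markovOp]
    simp only [real_inner_comm]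
  have h3 : (Fintype.card S : ℝ)⁻¹ * ∑ x ∈ F, ∑ s : S, ‖u x‖ ^ 2 = ∑ x ∈ F, ‖u x‖ ^ 2 := by
    simp only [Finset.sum_const, ← Finset.smul_sum, Finset.card_univ, Fintype.card_coe]
    rw [nsmul_eq_mul, inv_mul_cancel_left₀ h0]
  rw [sumInner_sub_left, h2, sumInner_self]
  simp only [norm_sub_sq_real, Finset.sum_add_distrib, Finset.sum_sub_distrib, mul_add, mul_sub]
  rw [h1, h3, ← sub_eq_zero]
  simp only [← Finset.mul_sum]
  ring

theorem sumInner_sub_markovOp_nonneg (hS : ∀ s ∈ S, s⁻¹ ∈ S) (hne : S.Nonempty) (u : G → E) :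
    0 ≤ sumInner F (u - markovOp S F u) u := by
  have := sum_norm_sub_sq_confinedStep (F := F) hS hne u
  have h : 0 ≤ (Fintype.card S : ℝ)⁻¹ *
    ∑ x ∈ F, ∑ s : S, ‖u x - u (confinedStep F x s)‖ ^ 2 := by positivity
  linarith

/-- That is, `1 + P ≥ 0`: twice the form `⟨(1 + P)u, u⟩` is the mean of the squares `‖u(xs) +
u(x)‖²`, with `xs` replaced by `x` for a suppressed step. -/
theorem neg_sumInner_markovOp_le (hS : ∀ s ∈ S, s⁻¹ ∈ S) (hne : S.Nonempty) (u : G → E) :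
    -sumInner F (markovOp S F u) u ≤ sumInner F u u := by
  have h0 : (S.card : ℝ) ≠ 0 := by exact_mod_cast hne.card_pos.ne'
  have h1 := sum_norm_sq_confinedStep (F := F) hS hne (fun x => ‖u x‖ ^ 2)
  have h3 : (Fintype.card S : ℝ)⁻¹ * ∑ x ∈ F, ∑ s : S, ‖u x‖ ^ 2 = ∑ x ∈ F, ‖u x‖ ^ 2 := by
    simp only [Finset.sum_const, ← Finset.smul_sum, Finset.card_univ, Fintype.card_coe]
    rw [nsmul_eq_mul, inv_mul_cancel_left₀ h0]
  have h4 : 0 ≤ (Fintype.card S : ℝ)⁻¹ *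
    ∑ x ∈ F, ∑ s : S, ‖u (confinedStep F x s) + u x‖ ^ 2 := by positivity
  simp only [norm_add_sq_real, Finset.sum_add_distrib, mul_add, ← Finset.mul_sum] at h4
  rw [h1, h3] at h4
  rw [sumInner_markovOp, sumInner_self]
  linarith

/-- With `w = (1 - P)u`, self-adjointness of `P` turns the difference of the two sides into `⟨(1 +
P)w, w⟩ ≥ 0`. -/
theorem dirichlet_markovOp_le (hS : ∀ s ∈ S, s⁻¹ ∈ S) (hne : S.Nonempty) (u : G → E) :
    sumInner F (markovOp S F u - markovOp S F (markovOp S F u)) (markovOp S F u) ≤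
      sumInner F (u - markovOp S F u) u := by
  have h := neg_sumInner_markovOp_le (F := F) hS hne (u - markovOp S F u)
  have e1 := sumInner_markovOp_comm (F := F) hS u u
  have e2 := sumInner_markovOp_comm (F := F) hS u (markovOp S F u)
  have e3 := sumInner_comm (F := F) (markovOp S F (markovOp S F u)) u
  have e4 := sumInner_comm (F := F) (markovOp S F (markovOp S F u)) (markovOp S F u)
  simp only [markovOp_sub, sumInner_sub_left, sumInner_sub_right] at h ⊢
  linarith

theorem dirichlet_iterate_le (hS : ∀ s ∈ S, s⁻¹ ∈ S) (hne : S.Nonempty) (u : G → E) (t : ℕ) :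
    sumInner F ((markovOp S F)^[t] u - (markovOp S F)^[t + 1] u) ((markovOp S F)^[t] u) ≤
      sumInner F (u - markovOp S F u) u := by
  induction t with
  | zero => simp
  | succ t ih =>
    simp only [Function.iterate_succ_apply'] at ih ⊢
    exact (dirichlet_markovOp_le hS hne _).trans ih

/-- For `v = P^t u`, positivity of the Dirichlet form at `u - v` bounds the mixed term `⟨u, (1 -
P)v⟩` by the mean of the forms at `u` and `v`, and the form does not increase under `P`. Summing
over `t` gives linear growth. -/
theorem sumInner_iterate_sub_le (hS : ∀ s ∈ S, s⁻¹ ∈ S) (hne : S.Nonempty) (u : G → E) (t : ℕ) :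
    sumInner F u ((markovOp S F)^[t] u) - sumInner F u ((markovOp S F)^[t + 1] u) ≤
      sumInner F (u - markovOp S F u) u := by
  have h1 := dirichlet_iterate_le (F := F) hS hne u t
  simp only [Function.iterate_succ_apply'] at h1 ⊢
  set v := (markovOp S F)^[t] u
  have h2 := sumInner_sub_markovOp_nonneg (F := F) hS hne (u - v)
  have e1 := sumInner_markovOp_comm (F := F) hS u v
  have e2 := sumInner_comm (F := F) (markovOp S F v) u
  have e3 := sumInner_comm (F := F) v u
  simp only [markovOp_sub, sumInner_sub_left, sumInner_sub_right] at h1 h2 ⊢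
  linarith

theorem sumInner_self_sub_iterate_le (hS : ∀ s ∈ S, s⁻¹ ∈ S) (hne : S.Nonempty) (u : G → E)
    (t : ℕ) : sumInner F u u - sumInner F u ((markovOp S F)^[t] u) ≤
      t * sumInner F (u - markovOp S F u) u := by
  induction t with
  | zero => simp
  | succ t ih =>
    have := sumInner_iterate_sub_le (F := F) hS hne u t
    push_cast
    linarith

theorem inner_iterate_markovOp (u : G → E) (t : ℕ) (v : E) (x : G) :
    ⟪v, (markovOp S F)^[t] u x⟫ =
      wordAvg S t fun w => ⟪v, u ((w.map (↑)).foldl (confinedStep F) x)⟫ := by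
  induction t generalizing x with
  | zero => simp
  | succ t ih =>
    rw [Function.iterate_succ_apply', markovOp, inner_smul_right, inner_sum, wordAvg_succ,
      div_eq_inv_mul]
    simp [ih]

theorem sum_wordAvg_foldl (hS : ∀ s ∈ S, s⁻¹ ∈ S) (hne : S.Nonempty) (φ : G → ℝ) (t : ℕ) :
    ∑ x ∈ F, wordAvg S t (fun w => φ ((w.map (↑)).foldl (confinedStep F) x)) =
      ∑ x ∈ F, φ x := by
  induction t with
  | zero => simp
  | succ t ih =>
    rw [← ih, ← sum_norm_sq_confinedStep (F := F) hS hne (fun x => wordAvg S t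
      (fun w => φ ((w.map (↑)).foldl (confinedStep F) x)))]
    simp only [wordAvg_succ, div_eq_inv_mul, Finset.mul_sum]
    simp

/-- Hilbert spaces have Markov type `2` with constant `1`, for the confined walk. -/
theorem sum_wordAvg_norm_sub_sq_le (hS : ∀ s ∈ S, s⁻¹ ∈ S) (hne : S.Nonempty) (u : G → E)
    (hu : ∀ x, ∀ s ∈ S, ‖u x - u (x * s)‖ ≤ 1) (t : ℕ) :
    ∑ x ∈ F, wordAvg S t
      (fun w => ‖u x - u ((w.map (↑)).foldl (confinedStep F) x)‖ ^ 2) ≤ t * F.card := by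
  have hne' : Nonempty S := hne.to_subtype
  have h0 : (0 : ℝ) < S.card := by exact_mod_cast hne.card_pos
  have h1 := sum_wordAvg_foldl (F := F) hS hne (fun x => ‖u x‖ ^ 2) t
  have h2 : ∑ x ∈ F, wordAvg S t
      (fun w => ‖u x - u ((w.map (↑)).foldl (confinedStep F) x)‖ ^ 2) =
      2 * (sumInner F u u - sumInner F u ((markovOp S F)^[t] u)) := by
    have h3 : sumInner F u ((markovOp S F)^[t] u) = ∑ x ∈ F, wordAvg S t
        fun w => ⟪u x, u ((w.map (↑)).foldl (confinedStep F) x)⟫ :=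
      Finset.sum_congr rfl fun x _ => inner_iterate_markovOp u t (u x) x
    rw [h3, sumInner_self]
    simp only [norm_sub_sq_real, wordAvg_add, wordAvg_sub, wordAvg_const, wordAvg_mul_left,
      Finset.sum_add_distrib, Finset.sum_sub_distrib, ← Finset.mul_sum]
    rw [h1]
    ring
  have h4 := sumInner_self_sub_iterate_le (F := F) hS hne u t
  have h5 := sum_norm_sub_sq_confinedStep (F := F) hS hne u
  have h6 : (Fintype.card S : ℝ)⁻¹ *
      ∑ x ∈ F, ∑ s : S, ‖u x - u (confinedStep F x s)‖ ^ 2 ≤ F.card := by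
    rw [Fintype.card_coe, inv_mul_le_iff₀ h0]
    calc ∑ x ∈ F, ∑ s : S, ‖u x - u (confinedStep F x s)‖ ^ 2
        ≤ ∑ x ∈ F, ∑ s : S, (1 : ℝ) := by
          refine Finset.sum_le_sum fun x _ => Finset.sum_le_sum fun s _ => ?_
          rw [confinedStep]
          split_ifs
          · have := hu x s s.2
            exact pow_le_one₀ (norm_nonneg _) this
          · simp
      _ = _ := by simp [mul_comm]
  rw [h2]
  have h7 : (0 : ℝ) ≤ t := Nat.cast_nonneg t
  nlinarith

/-- Every prefix of the word stays in the ball of radius `t` around `x`, so no step is ever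
suppressed. -/
theorem foldl_confinedStep {x : G} (t : ℕ) (hx : ∀ g, wordDist S 1 g ≤ t → x * g ∈ F)
    (w : List G) (hw : w.length ≤ t) (hwS : ∀ s ∈ w, s ∈ S) :
    w.foldl (confinedStep F) x = x * w.prod := by
  induction w using List.reverseRecOn with
  | nil => simp
  | append_singleton w a ih =>
    rw [List.length_append, List.length_singleton] at hw
    rw [List.foldl_append, ih (by omega) (fun s hs => hwS s (by simp [hs]))]
    have h := wordDist_le_length (S := S) (w ++ [a]) hwS
    have h' := hx (w ++ [a]).prod (h.trans (by simpa using hw))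
    simp only [List.prod_append, List.prod_singleton, ← mul_assoc] at h' ⊢
    simp [confinedStep, h']

end MarkovType

/-! ### Amenability and the random walk bound `2αβ ≤ 1`. -/

section UpperBound

variable (G : Type*) [Group G]

variable {G} in
open Classical in
/-- The elements of `F` whose right translates by `B` all lie in `F`. -/
noncomputable def stableCore (F B : Finset G) : Finset G := F.filter fun x => ∀ g ∈ B, x * g ∈ F

/-- Følner's condition. -/
def IsFolner : Prop :=
  ∀ (B : Finset G) (ε : ℝ), 0 < ε → ∃ F : Finset G, F.Nonempty ∧
    (1 - ε) * (F.card : ℝ) ≤ ((stableCore F B).card : ℝ)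

variable {G} {S : Finset G}

theorem mem_stableCore {F B : Finset G} {x : G} :
    x ∈ stableCore F B ↔ x ∈ F ∧ ∀ g ∈ B, x * g ∈ F := by
  simp [stableCore]

/-- From a point of the stable core the confined walk is the free walk, and `φ` depends on the
displacement only, so each such point contributes at least `c`. The core is at least half of `F`,
whence the factor `2`. -/
theorem IsFolner.wordAvg_norm_sq_le (hG : IsFolner G) (hS : IsSymmGenerating S)
    (hne : S.Nonempty) {E : Type*} [NormedAddCommGroup E] [InnerProductSpace ℝ E]
    (u : G → E) (hu : ∀ x, ∀ s ∈ S, ‖u x - u (x * s)‖ ≤ 1) (t : ℕ) (c : ℝ)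
    (φ : G → ℝ) (hφ : ∀ x g, φ g ≤ ‖u x - u (x * g)‖ ^ 2) (hφ0 : ∀ g, 0 ≤ φ g)
    (hc : c = wordAvg S t (fun w => φ (w.map (↑)).prod)) :
    c ≤ 2 * t := by
  obtain ⟨F, hF, hF'⟩ := hG (finite_wordBall hS t).toFinset (1 / 2) (by norm_num)
  set I := stableCore F (finite_wordBall hS t).toFinset
  have h1 := sum_wordAvg_norm_sub_sq_le (F := F) hS.1 hne u hu t
  have h2 : ∑ x ∈ I, c ≤ ∑ x ∈ F, wordAvg S t
      (fun w => ‖u x - u ((w.map (↑)).foldl (confinedStep F) x)‖ ^ 2) := by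
    refine (Finset.sum_le_sum fun x hx => ?_).trans (Finset.sum_le_sum_of_subset_of_nonneg
      (fun x hx => (mem_stableCore.1 hx).1) fun x _ _ => ?_)
    · rw [hc]
      refine wordAvg_mono fun w hw => ?_
      have hx' := (mem_stableCore.1 hx).2
      simp only [Set.Finite.mem_toFinset, Set.mem_ofPred_eq] at hx'
      rw [foldl_confinedStep t hx' _ (by simp [hw]) (by simp +contextual)]
      exact hφ _ _
    · refine le_trans ?_ (wordAvg_mono (F := fun _ => 0) fun l _ => by positivity)
      rw [wordAvg_eq_sum]
      simp
  have hc0 : 0 ≤ c := by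
    rw [hc, wordAvg_eq_sum]
    exact div_nonneg (Finset.sum_nonneg fun _ _ => hφ0 _) (by positivity)
  rw [Finset.sum_const, nsmul_eq_mul] at h2
  have hF0 : (0 : ℝ) < F.card := by exact_mod_cast hF.card_pos
  have h3 : c * F.card ≤ 2 * t * F.card := by nlinarith
  exact le_of_mul_le_mul_right h3 hF0

/-- The random walk upper bound for compression exponents of amenable groups. -/
theorem IsFolner.mul_le_one (hG : IsFolner G) (hS : IsSymmGenerating S) (hne : S.Nonempty)
    {α β : ℝ} (hβ : HasEscapeEstimate S β) (hα : α ∈ compressionExponents S) :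
    2 * α * β ≤ 1 := by
  classical
  obtain ⟨c, δ, hc, hδ, hesc⟩ := hβ
  obtain ⟨hα0, f, a, ha, hf1, hf2⟩ := hα
  have hnS : Nonempty S := hne.to_subtype
  have key : ∀ t : ℕ, 1 ≤ t → δ * (a * c ^ α) ^ 2 * (t : ℝ) ^ (2 * α * β) ≤ 2 * (t : ℝ) ^ (1 : ℝ) := by
    intro t ht
    have ht0 : (0 : ℝ) < t := by exact_mod_cast ht
    set r : ℝ := c * (t : ℝ) ^ β with hr
    have hr0 : 0 < r := by positivity
    have h := hG.wordAvg_norm_sq_le hS hne f (fun x s hs => (hf1 _ _).trans (by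
      rw [wordDist_eq_one_left]
      exact_mod_cast wordDist_one_le_one (by simpa using hs))) t _
      (fun g => (a * r ^ α) ^ 2 * if g ∈ {g : G | r ≤ (wordDist S g 1 : ℝ)} then 1 else 0)
      (fun x g => by
        split_ifs with hg
        · rw [Set.mem_ofPred_eq, hS.wordDist_one_right] at hg
          rw [mul_one]
          have hxg : x ≠ x * g := by
            intro h
            have : g = 1 := by simpa using h
            subst this
            rw [wordDist_self] at hg
            simp at hg
            linarith
          refine pow_le_pow_left₀ (by positivity) (le_trans ?_ (hf2 x (x * g) hxg)) 2
          rw [wordDist_eq_one_left, inv_mul_cancel_left]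
          gcongr
        · rw [mul_zero]; positivity)
      (fun g => by positivity) rfl
    rw [wordAvg_mul_left, ← walkProb_eq_wordAvg] at h
    have h2 := hesc t
    have h3 : (a * r ^ α) ^ 2 = (a * c ^ α) ^ 2 * (t : ℝ) ^ (2 * α * β) := by
      rw [hr, Real.mul_rpow hc.le (by positivity), ← Real.rpow_mul ht0.le, ← mul_assoc, mul_pow]
      congr 1
      rw [← Real.rpow_natCast, ← Real.rpow_mul ht0.le]
      congr 1
      push_cast
      ring
    rw [h3] at h
    rw [Real.rpow_one]
    have h4 : 0 ≤ (a * c ^ α) ^ 2 * (t : ℝ) ^ (2 * α * β) := by positivity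
    nlinarith
  by_contra hcon
  -- If `2αβ > 1`, then `t^{2αβ - 1}` tends to infinity and eventually violates `key`.
  push Not at hcon
  have hlim := (tendsto_rpow_atTop (sub_pos.2 hcon)).comp tendsto_natCast_atTop_atTop
  obtain ⟨t, ht1, ht2⟩ := ((hlim.eventually_gt_atTop (2 / (δ * (a * c ^ α) ^ 2))).and
    (Filter.eventually_ge_atTop 1)).exists
  have hp : 0 < δ * (a * c ^ α) ^ 2 := by positivity
  have ht0 : (0 : ℝ) < t := by exact_mod_cast ht2
  have h := key t ht2
  simp only [Function.comp_apply] at ht1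
  rw [Real.rpow_sub ht0, div_lt_div_iff₀ hp (by positivity)] at ht1
  linarith

end UpperBound

end HilbertCompression

namespace HilbertCompression

/-! ### Lamps, position and word length in `G ≀ ℤ`. -/

section Wreath

/-- The wreath product of `G` with `ℤ`. -/
abbrev ZWreath (G : Type) [Group G] : Type := wreathProduct G (Multiplicative ℤ)

namespace ZWreath

variable {G : Type} [Group G]

/-- The lamp configuration of an element of `G ≀ ℤ`. -/
def lamps (x : ZWreath G) (z : ℤ) : G := x.1.left (Multiplicative.ofAdd z)

/-- The position of the lamplighter of an element of `G ≀ ℤ`. -/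
def pos (x : ZWreath G) : ℤ := x.1.right.toAdd

theorem finite_lamps (x : ZWreath G) : {z | lamps x z ≠ 1}.Finite := x.2

/-- The element of `G ≀ ℤ` with given lamp configuration and position. -/
def mk (f : ℤ → G) (hf : {z | f z ≠ 1}.Finite) (n : ℤ) : ZWreath G :=
  ⟨⟨fun z => f z.toAdd, Multiplicative.ofAdd n⟩, hf⟩

@[simp] theorem lamps_mk (f : ℤ → G) (hf) (n : ℤ) : lamps (mk f hf n) = f := rfl

@[simp] theorem pos_mk (f : ℤ → G) (hf) (n : ℤ) : pos (mk f hf n) = n := rfl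

theorem ext {x y : ZWreath G} (h : lamps x = lamps y) (h' : pos x = pos y) : x = y :=
  Subtype.ext (RegularWreathProduct.ext h h')

@[simp] theorem lamps_one : lamps (1 : ZWreath G) = 1 := rfl

@[simp] theorem pos_one : pos (1 : ZWreath G) = 0 := rfl

theorem lamps_mul (x y : ZWreath G) (z : ℤ) :
    lamps (x * y) z = lamps x z * lamps y (z - pos x) := by
  rw [sub_eq_neg_add]
  rfl

@[simp] theorem pos_mul (x y : ZWreath G) : pos (x * y) = pos x + pos y := rfl

theorem lamps_inv (x : ZWreath G) (z : ℤ) : lamps x⁻¹ z = (lamps x (pos x + z))⁻¹ := rfl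

@[simp] theorem pos_inv (x : ZWreath G) : pos x⁻¹ = -pos x := rfl

/-- The generator multiplying the lamp at the current position by `g`. -/
def lampGen (g : G) : ZWreath G :=
  mk (fun z => if z = 0 then g else 1) ((Set.finite_singleton 0).subset fun z hz => by
    by_contra h
    exact hz (if_neg h)) 0

/-- The shift of the lamplighter by `n`. -/
def shift (G : Type) [Group G] (n : ℤ) : ZWreath G := mk (fun _ => 1) (by simp) n

@[simp] theorem lamps_lampGen (g : G) (z : ℤ) : lamps (lampGen g) z = if z = 0 then g else 1 := rfl

@[simp] theorem pos_lampGen (g : G) : pos (lampGen g) = 0 := rfl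

@[simp] theorem lamps_shift (n z : ℤ) : lamps (shift G n) z = 1 := rfl

@[simp] theorem pos_shift (n : ℤ) : pos (shift G n) = n := rfl

theorem lampGen_one : lampGen (1 : G) = 1 := ext (by ext; simp) rfl

theorem lampGen_mul (g h : G) : lampGen (g * h) = lampGen g * lampGen h :=
  ext (by ext z; by_cases hz : z = 0 <;> simp [lamps_mul, hz]) rfl

theorem lampGen_inv (g : G) : (lampGen g)⁻¹ = lampGen g⁻¹ :=
  ext (by ext z; by_cases hz : z = 0 <;> simp [lamps_inv, hz]) rfl

theorem lampGen_injective : Function.Injective (lampGen : G → ZWreath G) := by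
  intro g h e
  simpa using congrArg (fun x => lamps x 0) e

theorem shift_zero : shift G 0 = 1 := ext (by ext; simp) rfl

theorem shift_add (m n : ℤ) : shift G (m + n) = shift G m * shift G n :=
  ext (by ext; simp [lamps_mul]) rfl

theorem shift_inv (n : ℤ) : (shift G n)⁻¹ = shift G (-n) :=
  ext (by ext; simp [lamps_inv]) rfl

/-- The walk from `0` to `n` that sets the lamps in `[0, n)` according to `f`. -/
def sweep (f : ℕ → G) (n : ℕ) : ZWreath G :=
  ((List.range n).map fun i => lampGen (f i) * shift G 1).prod

theorem sweep_succ (f : ℕ → G) (n : ℕ) :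
    sweep f (n + 1) = sweep f n * (lampGen (f n) * shift G 1) := by
  simp [sweep, List.range_succ]

theorem pos_sweep (f : ℕ → G) (n : ℕ) : pos (sweep f n) = n := by
  induction n with
  | zero => rfl
  | succ n ih => rw [sweep_succ]; simp [ih]

theorem lamps_sweep (f : ℕ → G) (n : ℕ) (z : ℤ) :
    lamps (sweep f n) z = if 0 ≤ z ∧ z < n then f z.toNat else 1 := by
  induction n with
  | zero =>
    rw [if_neg (by push_cast; omega)]
    rfl
  | succ n ih =>
    rw [sweep_succ, lamps_mul, ih, lamps_mul, pos_sweep]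
    simp only [lamps_lampGen, lamps_shift, mul_one]
    push_cast
    by_cases h : z = n
    · subst h
      simp
    · rw [if_neg (show ¬(z - (n : ℤ) = 0) by omega), mul_one]
      congr 1
      simp only [eq_iff_iff]
      omega

/-- Every element is obtained by moving to the left end of its support, sweeping to the right end,
and moving to its position. -/
theorem eq_shift_mul_sweep_mul_shift (x : ZWreath G) (R : ℕ)
    (hR : ∀ z, lamps x z ≠ 1 → z.natAbs ≤ R) :
    x = shift G (-R) * sweep (fun i => lamps x (i - R)) (2 * R + 1) *
      shift G (pos x - (R + 1)) := by
  refine ext ?_ ?_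
  · ext z
    rw [lamps_mul, lamps_mul, lamps_sweep]
    simp only [lamps_shift, pos_shift, one_mul, mul_one, sub_neg_eq_add]
    split_ifs with h
    · congr 1
      omega
    · by_contra h'
      have := hR z h'
      omega
  · simp only [pos_mul, pos_shift, pos_sweep]
    push_cast
    ring

open Classical in
/-- The generators of `G ≀ ℤ` consisting of the lamp generators and the two shifts. -/
noncomputable def gens (S : Finset G) : Finset (ZWreath G) :=
  S.image lampGen ∪ {shift G 1, shift G (-1)}

theorem mem_gens {S : Finset G} {x : ZWreath G} :
    x ∈ gens S ↔ (∃ s ∈ S, lampGen s = x) ∨ x = shift G 1 ∨ x = shift G (-1) := by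
  simp only [gens, Finset.mem_union, Finset.mem_image, Finset.mem_insert, Finset.mem_singleton]

variable {S : Finset G}

theorem wordDist_shift_le (n : ℤ) : wordDist (gens S) 1 (shift G n) ≤ n.natAbs := by
  have key : ∀ (m : ℕ) (e : ℤ), e = 1 ∨ e = -1 →
      wordDist (gens S) 1 (shift G (m * e)) ≤ m := by
    intro m e he
    have : shift G (m * e) = (List.replicate m (shift G e)).prod := by
      induction m with
      | zero => simp [shift_zero]
      | succ m ih => rw [List.replicate_succ', List.prod_append, ← ih]; simp [← shift_add, add_mul]
    rw [this]
    refine (wordDist_le_length _ fun s hs => ?_).trans (by simp)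
    rw [List.eq_of_mem_replicate hs, mem_gens]
    rcases he with rfl | rfl <;> simp
  rcases le_total 0 n with h | h
  · have := key n.natAbs 1 (Or.inl rfl)
    rwa [mul_one, Int.natAbs_of_nonneg h] at this
  · have := key n.natAbs (-1) (Or.inr rfl)
    rwa [show ((n.natAbs : ℤ) * -1) = n by omega] at this

theorem lampGen_list_prod (l : List G) : lampGen l.prod = (l.map lampGen).prod := by
  induction l with
  | nil => exact lampGen_one
  | cons a l ih => simp [lampGen_mul, ih]

theorem isSymmGenerating_gens (hS : IsSymmGenerating S) : IsSymmGenerating (gens S) := by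
  constructor
  · intro s hs
    rw [mem_gens] at hs ⊢
    rcases hs with ⟨g, hg, rfl⟩ | rfl | rfl
    · exact Or.inl ⟨g⁻¹, hS.1 g hg, (lampGen_inv g).symm⟩
    · exact Or.inr (Or.inr (shift_inv 1))
    · exact Or.inr (Or.inl (by simp [shift_inv]))
  · have h1 : shift G 1 ∈ Subgroup.closure (gens S : Set (ZWreath G)) :=
      Subgroup.subset_closure (Finset.mem_coe.2 (mem_gens.2 (Or.inr (Or.inl rfl))))
    have h2 : ∀ n : ℤ, shift G n ∈ Subgroup.closure (gens S : Set (ZWreath G)) := by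
      intro n
      have : shift G n = shift G 1 ^ n := by
        induction n with
        | zero => simp [shift_zero]
        | succ n ih => rw [shift_add, ih, zpow_add, zpow_one]
        | pred n ih => rw [sub_eq_add_neg, shift_add, ih, zpow_add, ← shift_inv, zpow_neg_one]
      rw [this]
      exact Subgroup.zpow_mem _ h1 n
    have h3 : ∀ g : G, lampGen g ∈ Subgroup.closure (gens S : Set (ZWreath G)) := by
      intro g
      obtain ⟨l, hl, rfl⟩ := hS.exists_word g
      rw [lampGen_list_prod]
      refine Subgroup.list_prod_mem _ fun x hx => Subgroup.subset_closure ?_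
      obtain ⟨a, ha, rfl⟩ := List.mem_map.1 hx
      exact Finset.mem_coe.2 (mem_gens.2 (Or.inl ⟨a, hl a ha, rfl⟩))
    rw [eq_top_iff]
    intro x _
    obtain ⟨R, hR⟩ := ((finite_lamps x).image Int.natAbs).bddAbove
    rw [eq_shift_mul_sweep_mul_shift x R fun z hz => hR ⟨z, hz, rfl⟩]
    refine Subgroup.mul_mem _ (Subgroup.mul_mem _ (h2 _) ?_) (h2 _)
    refine Subgroup.list_prod_mem _ fun y hy => ?_
    obtain ⟨i, -, rfl⟩ := List.mem_map.1 hy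
    exact Subgroup.mul_mem _ (h3 _) h1

theorem wordDist_lampGen_le (hS : IsSymmGenerating S) (g : G) :
    wordDist (gens S) 1 (lampGen g) ≤ wordDist S 1 g := by
  obtain ⟨l, hl, hl', rfl⟩ := hS.exists_word_length g
  rw [← hl, lampGen_list_prod]
  refine (wordDist_le_length _ fun x hx => ?_).trans (by simp)
  obtain ⟨a, ha, rfl⟩ := List.mem_map.1 hx
  exact mem_gens.2 (Or.inl ⟨a, hl' a ha, rfl⟩)

theorem wordDist_sweep_le (hS : IsSymmGenerating S) (f : ℕ → G) (n : ℕ) :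
    wordDist (gens S) 1 (sweep f n) ≤ n + ∑ i ∈ Finset.range n, wordDist S 1 (f i) := by
  have hg := isSymmGenerating_gens hS
  induction n with
  | zero => simp [sweep, wordDist_self]
  | succ n ih =>
    rw [sweep_succ, Finset.sum_range_succ]
    have h1 := hg.wordDist_one_mul_le (sweep f n) (lampGen (f n) * shift G 1)
    have h2 := hg.wordDist_one_mul_le (lampGen (f n)) (shift G 1)
    have h3 := wordDist_lampGen_le hS (f n)
    have h4 := wordDist_shift_le (S := S) 1
    simp at h4
    omega

/-- The path goes to `-R`, sweeps `2R + 1` sites and ends at `pos x`: at most `R + (2R + 1) + (|pos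
x| + R + 1)` moves besides the cost of the lamps. -/
theorem wordDist_one_le (hS : IsSymmGenerating S) (x : ZWreath G) (R : ℕ)
    (hR : ∀ z, lamps x z ≠ 1 → z.natAbs ≤ R) :
    wordDist (gens S) 1 x ≤ 4 * R + 2 + (pos x).natAbs +
      ∑ z ∈ Finset.Icc (-(R : ℤ)) R, wordDist S 1 (lamps x z) := by
  have hg := isSymmGenerating_gens hS
  set f : ℕ → G := fun i => lamps x (i - R) with hf
  have e := eq_shift_mul_sweep_mul_shift x R hR
  have h1 := hg.wordDist_one_mul_le (shift G (-R) * sweep f (2 * R + 1))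
    (shift G (pos x - (R + 1)))
  have h2 := hg.wordDist_one_mul_le (shift G (-R)) (sweep f (2 * R + 1))
  have h3 := wordDist_shift_le (S := S) (-R)
  have h4 := wordDist_shift_le (S := S) (pos x - (R + 1))
  have h5 := wordDist_sweep_le hS f (2 * R + 1)
  rw [← e] at h1
  have h6 : ∑ i ∈ Finset.range (2 * R + 1), wordDist S 1 (f i) =
      ∑ z ∈ Finset.Icc (-(R : ℤ)) R, wordDist S 1 (lamps x z) := by
    refine Finset.sum_nbij' (fun i => (i : ℤ) - R) (fun z => (z + R).toNat) ?_ ?_ ?_ ?_ ?_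
    · intro i hi
      simp only [Finset.mem_range, Finset.mem_Icc] at hi ⊢
      omega
    · intro z hz
      simp only [Finset.mem_range, Finset.mem_Icc] at hz ⊢
      omega
    · intro i _
      simp
    · intro z hz
      simp only [Finset.mem_Icc] at hz
      omega
    · intro i _
      rfl
  omega

/-- A generator changes at most one lamp, and that by one element of `S`. -/
theorem sum_wordDist_lamps_le (hS : IsSymmGenerating S) (Z : Finset ℤ) (x : ZWreath G) :
    ∑ z ∈ Z, wordDist S 1 (lamps x z) ≤ wordDist (gens S) 1 x := by
  refine (isSymmGenerating_gens hS).le_wordDist_one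
    (fun x => ∑ z ∈ Z, wordDist S 1 (lamps x z)) (by simp [wordDist_self]) ?_ x
  intro x s hs
  rcases mem_gens.1 hs with ⟨g, hg, rfl⟩ | hs
  · calc ∑ z ∈ Z, wordDist S 1 (lamps (x * lampGen g) z)
        ≤ ∑ z ∈ Z, (wordDist S 1 (lamps x z) + if z = pos x then 1 else 0) := by
          refine Finset.sum_le_sum fun z _ => ?_
          rw [lamps_mul, lamps_lampGen]
          by_cases hz : z = pos x
          · rw [if_pos (by omega), if_pos hz]
            exact (hS.wordDist_one_mul_le _ _).trans
              (Nat.add_le_add_left (wordDist_one_le_one hg) _)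
          · rw [if_neg (by omega), if_neg hz, mul_one, add_zero]
      _ ≤ _ := by
          rw [Finset.sum_add_distrib, Finset.sum_ite_eq']
          split_ifs <;> simp
  · have : ∀ z, lamps (x * s) z = lamps x z := by
      intro z
      rcases hs with rfl | rfl <;> simp [lamps_mul]
    simp [this]

end ZWreath

end Wreath

end HilbertCompression

namespace HilbertCompression

/-! ### Embeddings of `G ≀ ℤ` into Hilbert space. -/

section WreathCompression

/-- The increments of `n^γ` are at most `n^{γ - 1}`, and `2(γ - 1) < -1` exactly when `γ < 1/2`.
This is why the half-line maps fall just short of detecting the range linearly. -/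
theorem summable_rpow_succ_sub_sq {γ : ℝ} (h0 : 0 < γ) (h1 : γ < 1 / 2) :
    Summable fun n : ℕ => ((n : ℝ) ^ γ - ((n + 1 : ℕ) : ℝ) ^ γ) ^ 2 := by
  rw [← summable_nat_add_iff 1]
  have hs : Summable fun n : ℕ => (((n + 1 : ℕ) : ℝ) ^ (2 * (γ - 1))) :=
    (summable_nat_add_iff 1).2 (Real.summable_nat_rpow.2 (by linarith))
  refine Summable.of_nonneg_of_le (fun _ => sq_nonneg _) (fun n => ?_) hs
  set x : ℝ := ((n + 1 : ℕ) : ℝ) with hx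
  have hx0 : 0 < x := by positivity
  have e : ((n + 1 + 1 : ℕ) : ℝ) = x * (1 + x⁻¹) := by
    rw [mul_add, mul_inv_cancel₀ hx0.ne', hx]
    push_cast
    ring
  have h2 : (1 + x⁻¹) ^ γ ≤ 1 + γ * x⁻¹ :=
    rpow_one_add_le_one_add_mul_self (by have := inv_pos.2 hx0; linarith) h0.le (by linarith)
  have h3 : (1 : ℝ) ≤ (1 + x⁻¹) ^ γ :=
    Real.one_le_rpow (by have := inv_pos.2 hx0; linarith) h0.le
  have hp : 0 < x ^ γ := by positivity
  have h4 : |x ^ γ - ((n + 1 + 1 : ℕ) : ℝ) ^ γ| ≤ x ^ (γ - 1) := by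
    rw [e, Real.mul_rpow hx0.le (by positivity), abs_sub_comm, abs_of_nonneg (by nlinarith),
      Real.rpow_sub_one hx0.ne', div_eq_mul_inv]
    have : γ * x⁻¹ ≤ x⁻¹ := by
      have := inv_pos.2 hx0
      nlinarith
    nlinarith
  rw [← sq_abs]
  calc _ ≤ (x ^ (γ - 1)) ^ 2 := pow_le_pow_left₀ (abs_nonneg _) h4 2
    _ = _ := by
      rw [← Real.rpow_natCast, ← Real.rpow_mul hx0.le]
      congr 1
      push_cast
      ring

/-- The upper half of the range suffices: at least `R/2` terms, each at least `(R/2)^{2γ}`. -/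
theorem rpow_le_sum_rpow_sq {γ : ℝ} (h0 : 0 < γ) (R : ℕ) :
    ((R : ℝ) / 2) ^ (2 * γ + 1) ≤ ∑ n ∈ Finset.Icc 1 R, ((n : ℝ) ^ γ) ^ 2 := by
  have h1 : ∑ n ∈ Finset.Ioc (R / 2) R, ((R : ℝ) / 2) ^ (2 * γ) ≤
      ∑ n ∈ Finset.Icc 1 R, ((n : ℝ) ^ γ) ^ 2 := by
    refine (Finset.sum_le_sum fun n hn => ?_).trans
      (Finset.sum_le_sum_of_subset_of_nonneg (fun n hn => ?_) fun n _ _ => sq_nonneg _)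
    · rw [Finset.mem_Ioc] at hn
      rw [← Real.rpow_natCast, ← Real.rpow_mul (by positivity), mul_comm γ]
      have : (R : ℝ) ≤ 2 * n := by
        have : R ≤ 2 * n := by omega
        exact_mod_cast this
      push_cast
      gcongr
      linarith
    · simp only [Finset.mem_Ioc, Finset.mem_Icc] at hn ⊢
      omega
  refine le_trans ?_ h1
  rw [Finset.sum_const, Nat.card_Ioc, nsmul_eq_mul]
  rcases Nat.eq_zero_or_pos R with rfl | hR
  · simp [Real.zero_rpow (by linarith : 2 * γ + 1 ≠ 0)]
  · rw [Real.rpow_add_one (by positivity), mul_comm]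
    gcongr
    have : R ≤ 2 * (R - R / 2) := by omega
    have : (R : ℝ) ≤ 2 * ((R - R / 2 : ℕ) : ℝ) := by exact_mod_cast this
    linarith

theorem norm_smul_sub_smul_sq {ι E : Type*} [NormedAddCommGroup E] [InnerProductSpace ℝ E]
    {v : ι → E} (hv : Orthonormal ℝ v) (a b : ℝ) {i j : ι} (h : i ≠ j) :
    ‖a • v i - b • v j‖ ^ 2 = a ^ 2 + b ^ 2 := by
  rw [norm_sub_sq_real, inner_smul_left, inner_smul_right, hv.2 h, norm_smul, norm_smul, hv.1,
    hv.1]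
  simp

theorem norm_smul_sub_smul_sq_same {ι E : Type*} [NormedAddCommGroup E] [InnerProductSpace ℝ E]
    {v : ι → E} (hv : Orthonormal ℝ v) (a b : ℝ) (i : ι) :
    ‖a • v i - b • v i‖ ^ 2 = (a - b) ^ 2 := by
  rw [← sub_smul, norm_smul, hv.1, mul_one, Real.norm_eq_abs, sq_abs]

/-- The function `n ↦ (max n 0) ^ γ`. -/
noncomputable def truncPow (γ : ℝ) (n : ℤ) : ℝ := (n.toNat : ℝ) ^ γ

theorem truncPow_of_nonpos {γ : ℝ} (h0 : 0 < γ) {n : ℤ} (hn : n ≤ 0) : truncPow γ n = 0 := by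
  rw [truncPow, Int.toNat_of_nonpos hn, Nat.cast_zero, Real.zero_rpow h0.ne']

theorem summable_truncPow {γ : ℝ} (h0 : 0 < γ) (h1 : γ < 1 / 2) :
    Summable fun n : ℤ => (truncPow γ n - truncPow γ (n + 1)) ^ 2 := by
  rw [← (Nat.cast_injective (R := ℤ)).summable_iff]
  · exact summable_rpow_succ_sub_sq h0 h1
  · intro n hn
    have : n < 0 := by
      by_contra h
      exact hn ⟨n.toNat, by simp; omega⟩
    rw [truncPow_of_nonpos h0 this.le, truncPow_of_nonpos h0 (by omega)]
    simp

/-- Shifts by `±1` of a translate and reflection of `truncPow` move it by a fixed amount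
in `ℓ²`. -/
theorem hasSum_truncPow {γ : ℝ} (h0 : 0 < γ) (h1 : γ < 1 / 2) (p : ℤ) {η : ℤ}
    (hη : η = 1 ∨ η = -1) :
    HasSum (fun y : ℤ => (truncPow γ (y - p) - truncPow γ (y - (p + η))) ^ 2)
      (∑' n : ℤ, (truncPow γ n - truncPow γ (n + 1)) ^ 2) := by
  have hs := (summable_truncPow h0 h1).hasSum
  rcases hη with rfl | rfl
  · convert (Equiv.subRight (p + 1)).hasSum_iff.2 hs using 2 with y
    simp only [Function.comp_apply, Equiv.subRight_apply]
    rw [← neg_sq]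
    congr 1
    rw [show y - (p + 1) + 1 = y - p by ring]
    ring
  · convert (Equiv.subRight p).hasSum_iff.2 hs using 2 with y
    simp only [Function.comp_apply, Equiv.subRight_apply]
    rw [show y - (p + -1) = y - p + 1 by ring]

namespace ZWreath

variable {G : Type} [Group G] {S : Finset G}

/-- The part of a configuration lying in the half-line `y ≤ e * k`. -/
noncomputable def halfLine (e y : ℤ) (f : ℤ → G) (k : ℤ) : G := if y ≤ e * k then f k else 1

/-- A map detecting how far the lamps of two elements differ from the position of the
lamplighter in the direction `e`. -/
theorem exists_map_halfLine (hS : IsSymmGenerating S) {γ : ℝ} (h0 : 0 < γ) (h1 : γ < 1 / 2)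
    {e : ℤ} (he : e = 1 ∨ e = -1) :
    ∃ (E : Type) (_ : NormedAddCommGroup E) (_ : InnerProductSpace ℝ E) (_ : CompleteSpace E)
      (Φ : ZWreath G → E) (C : ℝ), (∀ x, ∀ s ∈ gens S, ‖Φ x - Φ (x * s)‖ ^ 2 ≤ C) ∧
      ∀ x y, ∀ (R : ℕ) (k : ℤ), e * (k - pos x) = R → lamps x k ≠ lamps y k →
        ((R : ℝ) / 2) ^ (2 * γ + 1) ≤ ‖Φ x - Φ y‖ ^ 2 := by
  let b : HilbertBasis (ℤ → G) ℝ (lp (fun _ : ℤ → G => ℝ) 2) :=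
    HilbertBasis.ofRepr (LinearIsometryEquiv.refl ℝ _)
  have hb : Orthonormal ℝ b := b.orthonormal
  -- At level `y` the basis vector records the configuration from `y` on in direction `e`, and the
  -- weight vanishes unless `y` is strictly ahead of the lamplighter. Switching the current lamp
  -- therefore changes nothing, a shift changes only the weights, and different records are
  -- orthogonal.
  let F : ℤ → ZWreath G → lp (fun _ : ℤ → G => ℝ) 2 := fun y x =>
    truncPow γ (y - e * pos x) • b (halfLine e y (lamps x))
  have hedge : ∀ x, ∀ s ∈ gens S, Summable (fun y => ‖F y x - F y (x * s)‖ ^ 2) ∧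
      ∑' y, ‖F y x - F y (x * s)‖ ^ 2 ≤
        ∑' n : ℤ, (truncPow γ n - truncPow γ (n + 1)) ^ 2 := by
    intro x s hs
    rcases mem_gens.1 hs with ⟨g, hg, rfl⟩ | hs
    · have hz : ∀ y, ‖F y x - F y (x * lampGen g)‖ ^ 2 = 0 := by
        intro y
        simp only [F, pos_mul, pos_lampGen, add_zero]
        by_cases hy : y ≤ e * pos x
        · rw [truncPow_of_nonpos h0 (by omega)]
          simp
        · have : halfLine e y (lamps (x * lampGen g)) = halfLine e y (lamps x) := by
            ext k
            rw [halfLine, halfLine]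
            split_ifs with hk
            · rw [lamps_mul, lamps_lampGen, if_neg, mul_one]
              intro hk'
              rw [sub_eq_zero.1 hk'] at hk
              exact hy hk
            · rfl
          rw [this]
          simp
      simp only [hz]
      exact ⟨summable_zero, by rw [tsum_zero]; exact tsum_nonneg fun _ => sq_nonneg _⟩
    · obtain ⟨η, hη, rfl⟩ : ∃ η : ℤ, (η = 1 ∨ η = -1) ∧ s = shift G η := by
        rcases hs with rfl | rfl
        exacts [⟨1, Or.inl rfl, rfl⟩, ⟨-1, Or.inr rfl, rfl⟩]
      have h := hasSum_truncPow h0 h1 (e * pos x) (η := e * η)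
        (by rcases he with rfl | rfl <;> rcases hη with rfl | rfl <;> simp)
      have hz : ∀ y, ‖F y x - F y (x * shift G η)‖ ^ 2 =
          (truncPow γ (y - e * pos x) - truncPow γ (y - (e * pos x + e * η))) ^ 2 := by
        intro y
        have : lamps (x * shift G η) = lamps x := by ext k; simp [lamps_mul]
        simp only [F, pos_mul, pos_shift, this, norm_smul_sub_smul_sq_same hb]
        rw [mul_add]
      simp only [hz]
      exact ⟨h.summable, h.tsum_eq.le⟩
  obtain ⟨Φ, hΦ1, hΦ2⟩ := (isSymmGenerating_gens hS).exists_map_lp F _ hedge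
  refine ⟨_, inferInstance, inferInstance, inferInstance, Φ, _, hΦ1, ?_⟩
  intro x y R k hR hk
  -- All levels `e * pos x + n` with `1 ≤ n ≤ R` record the lamp at `k`, so there the two vectors
  -- are orthogonal and the weight `n^γ` of `x` alone gives the bound.
  refine (rpow_le_sum_rpow_sq h0 R).trans (le_trans ?_
    (hΦ2 x y ((Finset.Icc 1 R).image fun n : ℕ => e * pos x + n)))
  rw [Finset.sum_image fun a _ b _ h => by simpa using h]
  refine Finset.sum_le_sum fun n hn => ?_
  simp only [F]
  rw [norm_smul_sub_smul_sq hb]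
  · rw [add_sub_cancel_left]
    simp only [truncPow, Int.toNat_natCast]
    linarith [sq_nonneg (((e * pos x + n - e * pos y).toNat : ℝ) ^ γ)]
  · intro h
    have := congrFun h k
    rw [Finset.mem_Icc] at hn
    have hle : e * pos x + n ≤ e * k := by
      rw [mul_sub] at hR
      omega
    rw [halfLine, halfLine, if_pos hle, if_pos hle] at this
    exact hk this

/-- The map applying a `1`-Lipschitz map to each lamp. -/
theorem exists_map_lamps (hS : IsSymmGenerating S) {E : Type} [NormedAddCommGroup E]
    (f : G → E) (hf : ∀ x, ∀ s ∈ S, ‖f x - f (x * s)‖ ≤ 1) :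
    ∃ Φ : ZWreath G → lp (fun _ : ℤ => E) 2, (∀ x, ∀ s ∈ gens S, ‖Φ x - Φ (x * s)‖ ^ 2 ≤ 1) ∧
      ∀ x y, ∀ Z : Finset ℤ, ∑ z ∈ Z, ‖f (lamps x z) - f (lamps y z)‖ ^ 2 ≤ ‖Φ x - Φ y‖ ^ 2 := by
  refine (isSymmGenerating_gens hS).exists_map_lp (fun z x => f (lamps x z)) 1 ?_
  intro x s hs
  rcases mem_gens.1 hs with ⟨g, hg, rfl⟩ | hs
  · have hz : ∀ z, z ≠ pos x → ‖f (lamps x z) - f (lamps (x * lampGen g) z)‖ ^ 2 = 0 := by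
      intro z hz
      rw [lamps_mul, lamps_lampGen, if_neg (sub_ne_zero.2 hz)]
      simp
    refine ⟨(hasSum_single _ hz).summable, ?_⟩
    rw [tsum_eq_single _ hz, lamps_mul, lamps_lampGen, if_pos (sub_self _)]
    exact pow_le_one₀ (norm_nonneg _) (hf _ g hg)
  · have : ∀ z, lamps (x * s) z = lamps x z := by
      intro z
      rcases hs with rfl | rfl <;> simp [lamps_mul]
    simp [this]

/-- The numerical core of the lower bound for the compression of wreath products. -/
theorem rpow_le_of_bounds {α θ c N D n R : ℝ} (hα : 1 / 2 ≤ α) (hθ : 0 < θ) (hθ1 : θ ≤ 1)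
    (hc : 0 < c) (hc1 : c ≤ 1) (hn : n ≤ N) (hR0 : 0 ≤ R) (hR : (R / 2) ^ θ ≤ N)
    {ι : Type*} (Z : Finset ι) (d : ι → ℝ) (hd : ∀ z, 0 ≤ d z) (hZ : (Z.card : ℝ) ≤ 2 * R + 1)
    (hN : c ^ 2 * ∑ z ∈ Z, d z ^ (2 * α) ≤ N ^ 2) (hcN : c ≤ N) (hD0 : 0 ≤ D)
    (hD : D ≤ 4 * R + 2 + n + ∑ z ∈ Z, d z) :
    c / 16 * D ^ (θ * (2 * α / (2 * α + 1))) ≤ N := by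
  obtain ⟨M, rfl⟩ : ∃ M, N = c * M := ⟨N / c, by field_simp⟩
  have hM : 1 ≤ M := by
    by_contra h
    nlinarith
  have hM0 : 0 < M := by linarith
  have hcM : c * M ≤ M := by nlinarith
  -- `Q` is the scale of the range `R` and `P` below is the scale of the distance `D`; the final
  -- exponent is the one that turns `P` back into `M`.
  set Q : ℝ := M ^ θ⁻¹ with hQ
  have hMQ : M ≤ Q := by
    simpa using Real.rpow_le_rpow_of_exponent_le hM ((one_le_inv₀ hθ).2 hθ1)
  have hQ1 : 1 ≤ Q := hM.trans hMQ
  have hQ0 : 0 < Q := by linarith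
  set P : ℝ := Q ^ ((2 * α + 1) / (2 * α)) with hP
  have hQP : Q ≤ P := by
    simpa using Real.rpow_le_rpow_of_exponent_le hQ1
      (show 1 ≤ (2 * α + 1) / (2 * α) by rw [le_div_iff₀ (by linarith)]; linarith)
  have hP0 : 0 < P := by linarith
  have hR' : R ≤ 2 * Q := by
    have := (Real.le_rpow_inv_iff_of_pos (by positivity) hM0.le hθ).2 (hR.trans hcM)
    linarith
  have hsum : ∑ z ∈ Z, d z ^ (2 * α) ≤ Q ^ 2 := by
    have : c ^ 2 * ∑ z ∈ Z, d z ^ (2 * α) ≤ c ^ 2 * M ^ 2 := by rwa [← mul_pow]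
    exact (le_of_mul_le_mul_left this (by positivity)).trans (by gcongr)
  have hA : ∑ z ∈ Z, d z ≤ 5 * P := by
    -- Hölder over at most `2R + 1 ≤ 5Q` lamps.
    have h1 := Real.rpow_sum_le_const_mul_sum_rpow_of_nonneg Z (f := d)
      (show 1 ≤ 2 * α by linarith) (fun z _ => hd z)
    have hA0 : 0 ≤ ∑ z ∈ Z, d z := Finset.sum_nonneg fun z _ => hd z
    have h2 : (∑ z ∈ Z, d z) ^ (2 * α) ≤ (5 * P) ^ (2 * α) := by
      calc (∑ z ∈ Z, d z) ^ (2 * α) ≤ (5 * Q) ^ (2 * α - 1) * Q ^ 2 := by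
            refine h1.trans ?_
            gcongr
            · exact Finset.sum_nonneg fun z _ => Real.rpow_nonneg (hd z) _
            · linarith
            · linarith
        _ ≤ 5 ^ (2 * α) * Q ^ (2 * α + 1) := by
            rw [Real.mul_rpow (by norm_num) hQ0.le, mul_assoc]
            gcongr
            · norm_num
            · linarith
            · rw [← Real.rpow_natCast, ← Real.rpow_add hQ0]
              apply le_of_eq
              congr 1
              push_cast
              ring
        _ = _ := by
            rw [Real.mul_rpow (by norm_num) hP0.le, hP, ← Real.rpow_mul hQ0.le]
            congr 2
            field_simp
    exact (Real.rpow_le_rpow_iff hA0 (by positivity) (by linarith)).1 h2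
  -- `4R ≤ 8Q`, `2 ≤ 2Q`, `n ≤ Q`, the sum is at most `5P`, and `Q ≤ P`.
  have hDP : D ≤ 16 * P := by nlinarith
  have hτ0 : 0 ≤ θ * (2 * α / (2 * α + 1)) := by positivity
  have hτ1 : θ * (2 * α / (2 * α + 1)) ≤ 1 := by
    refine mul_le_one₀ hθ1 (by positivity) ?_
    rw [div_le_one (by linarith)]
    linarith
  have hPM : P ^ (θ * (2 * α / (2 * α + 1))) = M := by
    rw [hP, hQ, ← Real.rpow_mul hM0.le, ← Real.rpow_mul hM0.le]
    convert Real.rpow_one M using 2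
    field_simp
  have h16 : (16 : ℝ) ^ (θ * (2 * α / (2 * α + 1))) ≤ 16 := by
    simpa using Real.rpow_le_rpow_of_exponent_le (show (1 : ℝ) ≤ 16 by norm_num) hτ1
  have hfin : D ^ (θ * (2 * α / (2 * α + 1))) ≤ 16 * M := by
    calc _ ≤ (16 * P) ^ (θ * (2 * α / (2 * α + 1))) := by gcongr
      _ = 16 ^ (θ * (2 * α / (2 * α + 1))) * M := by
        rw [Real.mul_rpow (by norm_num) hP0.le, hPM]
      _ ≤ _ := by gcongr
  nlinarith

theorem exists_support_radius (h : ZWreath G) :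
    ∃ R : ℕ, (∀ z, lamps h z ≠ 1 → z.natAbs ≤ R) ∧
      (R = 0 ∨ ∃ z, lamps h z ≠ 1 ∧ z.natAbs = R) := by
  set A := (finite_lamps h).toFinset with hA
  refine ⟨A.sup Int.natAbs, fun z hz => Finset.le_sup (by simpa [hA] using hz), ?_⟩
  rcases A.eq_empty_or_nonempty with h0 | h0
  · left
    simp [h0]
  · right
    obtain ⟨z, hz, hz'⟩ := Finset.exists_mem_eq_sup A h0 Int.natAbs
    exact ⟨z, by simpa [hA] using hz, hz'.symm⟩

/-- Compression exponents of `G ≀ ℤ` obtained from those of `G`. -/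
theorem mul_mem_compressionExponents (hS : IsSymmGenerating S) {α θ : ℝ}
    (hα : α ∈ compressionExponents S) (hα2 : 1 / 2 ≤ α) (hθ : 1 / 2 < θ) (hθ1 : θ < 1) :
    θ * (2 * α / (2 * α + 1)) ∈ compressionExponents (gens S) := by
  obtain ⟨-, f, c₀, hc₀, hf1, hf2⟩ := hα
  set c := min c₀ 1 with hc
  have hc0 : 0 < c := lt_min hc₀ one_pos
  have hg := isSymmGenerating_gens hS
  -- With `γ = θ - 1/2` the squared bound `(R/2)^{2γ + 1}` becomes `((R/2)^θ)²`.
  obtain ⟨E₁, _, _, _, Φ₁, C₁, hΦ₁, hl₁⟩ := exists_map_halfLine (G := G) hS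
    (γ := θ - 1 / 2) (by linarith) (by linarith) (e := 1) (Or.inl rfl)
  obtain ⟨E₂, _, _, _, Φ₂, C₂, hΦ₂, hl₂⟩ := exists_map_halfLine (G := G) hS
    (γ := θ - 1 / 2) (by linarith) (by linarith) (e := -1) (Or.inr rfl)
  obtain ⟨Φ₃, hΦ₃, hl₃⟩ := exists_map_lamps hS f fun x s hs => (hf1 _ _).trans (by
    rw [wordDist_eq_one_left]
    exact_mod_cast wordDist_one_le_one (by simpa using hs))
  let Φ : ZWreath G → WithLp 2 (WithLp 2 (ℝ × E₁) × WithLp 2 (E₂ × lp (fun _ : ℤ =>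
      MeasureTheory.Lp ℝ 2 (MeasureTheory.volume : MeasureTheory.Measure ℝ)) 2)) := fun x =>
    WithLp.toLp 2 (WithLp.toLp 2 ((pos x : ℝ), Φ₁ x), WithLp.toLp 2 (Φ₂ x, Φ₃ x))
  have hΦ : ∀ x y, ‖Φ x - Φ y‖ ^ 2 = ((pos x : ℝ) - pos y) ^ 2 + ‖Φ₁ x - Φ₁ y‖ ^ 2 +
      (‖Φ₂ x - Φ₂ y‖ ^ 2 + ‖Φ₃ x - Φ₃ y‖ ^ 2) := by
    intro x y
    rw [WithLp.prod_norm_sq_eq_of_L2, WithLp.prod_norm_sq_eq_of_L2, WithLp.prod_norm_sq_eq_of_L2]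
    simp [Φ]
  refine hg.mem_compressionExponents hg Φ (C := √(1 + C₁ + (C₂ + 1))) (c := c / 16) (by positivity)
    ?_ (by positivity) ?_
  · intro x s hs
    refine Real.le_sqrt_of_sq_le ?_
    rw [hΦ]
    have h1 := hΦ₁ x s hs
    have h2 := hΦ₂ x s hs
    have h3 := hΦ₃ x s hs
    have h4 : ((pos x : ℝ) - pos (x * s)) ^ 2 ≤ 1 := by
      rcases mem_gens.1 hs with ⟨g, hg, rfl⟩ | rfl | rfl <;> simp
    linarith
  · intro x y hxy
    set h := x⁻¹ * y with hh
    have hlh : ∀ z, lamps h z = (lamps x (pos x + z))⁻¹ * lamps y (pos x + z) := by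
      intro z
      rw [hh, lamps_mul, lamps_inv, pos_inv, sub_neg_eq_add, add_comm z]
    have hne : ∀ z, lamps h z ≠ 1 → lamps x (pos x + z) ≠ lamps y (pos x + z) := by
      intro z hz e
      exact hz (by rw [hlh, e, inv_mul_cancel])
    obtain ⟨R, hR, hR'⟩ := exists_support_radius h
    set N := ‖Φ x - Φ y‖ with hN
    have hN0 : 0 ≤ N := norm_nonneg _
    have hN2 := hΦ x y
    rw [← hN] at hN2
    set Z := Finset.Icc (-(R : ℤ)) R
    have hsumN : c ^ 2 * ∑ z ∈ Z, (wordDist S 1 (lamps h z) : ℝ) ^ (2 * α) ≤ N ^ 2 := by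
      have h3 := hl₃ x y (Z.map (Equiv.addLeft (pos x)).toEmbedding)
      rw [Finset.sum_map] at h3
      have h4 : c ^ 2 * ∑ z ∈ Z, (wordDist S 1 (lamps h z) : ℝ) ^ (2 * α) ≤
          ∑ z ∈ Z, ‖f (lamps x (pos x + z)) - f (lamps y (pos x + z))‖ ^ 2 := by
        rw [Finset.mul_sum]
        refine Finset.sum_le_sum fun z _ => ?_
        by_cases hz : lamps x (pos x + z) = lamps y (pos x + z)
        · rw [hlh, hz, inv_mul_cancel, wordDist_self, Nat.cast_zero,
            Real.zero_rpow (by linarith)]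
          simp
        · have h5 := hf2 _ _ hz
          rw [wordDist_eq_one_left, ← hlh] at h5
          calc c ^ 2 * (wordDist S 1 (lamps h z) : ℝ) ^ (2 * α)
              = (c * (wordDist S 1 (lamps h z) : ℝ) ^ α) ^ 2 := by
                rw [mul_pow, ← Real.rpow_natCast (_ ^ α), ← Real.rpow_mul (by positivity)]
                congr 2
                push_cast
                ring
            _ ≤ _ := by
                refine pow_le_pow_left₀ (by positivity) (le_trans ?_ h5) 2
                gcongr
                exact min_le_left _ _
      simp only [Equiv.toEmbedding_apply, Equiv.coe_addLeft] at h3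
      nlinarith [sq_nonneg ((pos x : ℝ) - pos y), sq_nonneg ‖Φ₁ x - Φ₁ y‖,
        sq_nonneg ‖Φ₂ x - Φ₂ y‖]
    have hpos : ((pos h).natAbs : ℝ) ≤ N := by
      refine (sq_le_sq₀ (by positivity) hN0).1 ?_
      rw [Nat.cast_natAbs, Int.cast_abs, sq_abs, hh, pos_mul, pos_inv]
      push_cast
      nlinarith [sq_nonneg ‖Φ₁ x - Φ₁ y‖, sq_nonneg ‖Φ₂ x - Φ₂ y‖, sq_nonneg ‖Φ₃ x - Φ₃ y‖]
    have hRN : ((R : ℝ) / 2) ^ θ ≤ N := by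
      rcases hR' with hR' | ⟨z, hz, hz'⟩
      · rw [hR', Nat.cast_zero, zero_div, Real.zero_rpow (by linarith)]
        exact hN0
      · refine (sq_le_sq₀ (by positivity) hN0).1 ?_
        have e : (((R : ℝ) / 2) ^ θ) ^ 2 = ((R : ℝ) / 2) ^ (2 * (θ - 1 / 2) + 1) := by
          rw [← Real.rpow_natCast, ← Real.rpow_mul (by positivity)]
          congr 1
          push_cast
          ring
        rw [e]
        rcases Int.natAbs_eq z with h | h
        · have := hl₁ x y R (pos x + z) (by omega) (hne z hz)
          nlinarith [sq_nonneg ((pos x : ℝ) - pos y), sq_nonneg ‖Φ₂ x - Φ₂ y‖,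
            sq_nonneg ‖Φ₃ x - Φ₃ y‖]
        · have := hl₂ x y R (pos x + z) (by omega) (hne z hz)
          nlinarith [sq_nonneg ((pos x : ℝ) - pos y), sq_nonneg ‖Φ₁ x - Φ₁ y‖,
            sq_nonneg ‖Φ₃ x - Φ₃ y‖]
    -- Distinct elements differ in position, giving `N ≥ 1`, or in some lamp, giving `N ≥ c`; hence
    -- the truncation of `c` at `1`.
    have hcN : c ≤ N := by
      by_cases hp : pos h = 0
      · obtain ⟨z, hz⟩ : ∃ z, lamps h z ≠ 1 := by
          by_contra hcon
          push Not at hcon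
          have : h = 1 := ext (funext hcon) hp
          exact hxy (inv_mul_eq_one.1 this)
        refine (sq_le_sq₀ hc0.le hN0).1 (le_trans ?_ hsumN)
        refine le_mul_of_one_le_right (by positivity) ?_
        have hzZ : z ∈ Z := by
          have := hR z hz
          rw [Finset.mem_Icc]
          omega
        refine le_trans ?_ (Finset.single_le_sum (f := fun z =>
          (wordDist S 1 (lamps h z) : ℝ) ^ (2 * α)) (fun _ _ => by positivity) hzZ)
        refine Real.one_le_rpow ?_ (by linarith)
        exact_mod_cast hS.wordDist_pos hz.symm
      · refine le_trans (min_le_right _ _) (le_trans ?_ hpos)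
        have : 1 ≤ (pos h).natAbs := by omega
        exact_mod_cast this
    refine rpow_le_of_bounds hα2 (by linarith) hθ1.le hc0 (min_le_right _ _) hpos
      (Nat.cast_nonneg R) hRN Z (fun z => (wordDist S 1 (lamps h z) : ℝ))
      (fun _ => Nat.cast_nonneg _) ?_ hsumN hcN (Nat.cast_nonneg _) ?_
    · rw [Int.card_Icc]
      have : ((R : ℤ) + 1 - -(R : ℤ)).toNat = 2 * R + 1 := by omega
      rw [this]
      push_cast
      exact le_rfl
    · rw [wordDist_eq_one_left]
      exact_mod_cast wordDist_one_le hS h R hR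

end ZWreath

end WreathCompression

end HilbertCompression

namespace HilbertCompression

/-! ### Local times of the lamplighter: many sites with many lamp moves. -/

section LocalTime

variable {L : Type*}

/-- The displacement of the lamplighter coded by a Boolean. -/
def boolStep (b : Bool) : ℤ := if b then 1 else -1

/-- The sum of `φ` over the positions at which the lamplighter, started at `y`, executes the lamp
letters of a word. -/
def lampSum {M : Type*} [AddCommMonoid M] (φ : ℤ → M) : ℤ → List (L ⊕ Bool) → M
  | _, [] => 0
  | y, Sum.inl _ :: w => φ y + lampSum φ y w
  | y, Sum.inr b :: w => lampSum φ (y + boolStep b) w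

/-- The final position of the lamplighter started at `y`. -/
def endPos : ℤ → List (L ⊕ Bool) → ℤ
  | y, [] => y
  | y, Sum.inl _ :: w => endPos y w
  | y, Sum.inr b :: w => endPos (y + boolStep b) w

/-- The number of lamp letters executed at `z` by the lamplighter started at `y`. -/
def occ (z : ℤ) : ℤ → List (L ⊕ Bool) → ℕ := lampSum fun k => if k = z then 1 else 0

/-- The self-intersection energy of the sequence of positions of the lamp letters. -/
def energy : List (L ⊕ Bool) → ℕ
  | [] => 0
  | Sum.inl _ :: w => energy w + 2 * occ 0 0 w + 1
  | Sum.inr _ :: w => energy w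

@[simp] theorem occ_nil (z y : ℤ) : occ z y ([] : List (L ⊕ Bool)) = 0 := rfl

@[simp] theorem occ_inl (z y : ℤ) (a : L) (w : List (L ⊕ Bool)) :
    occ z y (Sum.inl a :: w) = (if y = z then 1 else 0) + occ z y w := rfl

@[simp] theorem occ_inr (z y : ℤ) (b : Bool) (w : List (L ⊕ Bool)) :
    occ z y (Sum.inr b :: w) = occ z (y + boolStep b) w := rfl

theorem occ_add (k z y : ℤ) (w : List (L ⊕ Bool)) : occ (z + k) (y + k) w = occ z y w := by
  induction w generalizing y with
  | nil => rfl
  | cons a w ih =>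
    rcases a with a | b
    · simp [ih]
    · rw [occ_inr, occ_inr, add_right_comm, ih]

theorem occ_self (y : ℤ) (w : List (L ⊕ Bool)) : occ y y w = occ 0 0 w := by
  simpa using occ_add y 0 0 w

/-- Prepending a lamp letter at `y` raises `occ y` by one, hence its square by `2 * occ + 1`;
translation invariance lets `energy` measure this from `0`. -/
theorem sum_occ_sq_le_energy (Z : Finset ℤ) (y : ℤ) (w : List (L ⊕ Bool)) :
    ∑ z ∈ Z, occ z y w ^ 2 ≤ energy w := by
  induction w generalizing y with
  | nil => simp
  | cons a w ih =>
    rcases a with a | b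
    · calc ∑ z ∈ Z, occ z y (Sum.inl a :: w) ^ 2
          = ∑ z ∈ Z, (occ z y w ^ 2 + if y = z then 2 * occ 0 0 w + 1 else 0) := by
            refine Finset.sum_congr rfl fun z _ => ?_
            rw [occ_inl]
            split_ifs with h
            · subst h
              rw [occ_self]
              ring
            · simp
        _ ≤ energy w + (2 * occ 0 0 w + 1) := by
            rw [Finset.sum_add_distrib, Finset.sum_ite_eq]
            refine add_le_add (ih y) ?_
            split_ifs <;> simp
        _ = _ := by rw [energy, add_assoc]
    · exact ih _

theorem lampSum_mono {φ ψ : ℤ → ℝ} (h : ∀ k, φ k ≤ ψ k) (y : ℤ) (w : List (L ⊕ Bool)) :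
    lampSum φ y w ≤ lampSum ψ y w := by
  induction w generalizing y with
  | nil => exact le_rfl
  | cons a w ih =>
    rcases a with a | b
    exacts [add_le_add (h y) (ih y), ih _]

theorem lampSum_add_mul (φ ψ : ℤ → ℝ) (c : ℝ) (y : ℤ) (w : List (L ⊕ Bool)) :
    lampSum (fun k => φ k + c * ψ k) y w = lampSum φ y w + c * lampSum ψ y w := by
  induction w generalizing y with
  | nil => simp [lampSum]
  | cons a w ih =>
    rcases a with a | b
    · simp only [lampSum, ih]
      ring
    · exact ih _

theorem sum_occ (Z : Finset ℤ) (y : ℤ) (w : List (L ⊕ Bool)) :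
    ∑ z ∈ Z, (occ z y w : ℝ) = lampSum (fun k => if k ∈ Z then 1 else 0) y w := by
  induction w generalizing y with
  | nil => simp [lampSum]
  | cons a w ih =>
    rcases a with a | b
    · simp [lampSum, ← ih, Finset.sum_add_distrib]
    · exact ih _

variable [Fintype L]

theorem wordAvg_sum_succ (t : ℕ) (F : List (L ⊕ Bool) → ℝ) :
    wordAvg (L ⊕ Bool) (t + 1) F = ((∑ a : L, wordAvg (L ⊕ Bool) t fun w => F (Sum.inl a :: w)) +
      ((wordAvg (L ⊕ Bool) t fun w => F (Sum.inr true :: w)) +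
        (wordAvg (L ⊕ Bool) t fun w => F (Sum.inr false :: w)))) / (Fintype.card L + 2) := by
  rw [wordAvg_succ, Fintype.sum_sum_type, Fintype.card_sum, Fintype.card_bool]
  simp

/-- The discrete Laplacian of `|n|` is `2δ₀`; this is what makes Tanaka's formula work. -/
theorem abs_add_one_add_abs_sub_one (n : ℤ) :
    |((n : ℝ) + 1)| + |(n : ℝ) - 1| = 2 * |(n : ℝ)| + if n = 0 then 2 else 0 := by
  rcases lt_trichotomy n 0 with h | h | h
  · have : (n : ℝ) + 1 ≤ 0 := by exact_mod_cast h
    rw [if_neg h.ne, abs_of_nonpos this, abs_of_nonpos (by linarith), abs_of_nonpos (by linarith)]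
    ring
  · subst h
    norm_num
  · have : (1 : ℝ) ≤ n := by exact_mod_cast h
    rw [if_neg h.ne', abs_of_nonneg (by linarith), abs_of_nonneg (by linarith),
      abs_of_nonneg (by linarith)]
    ring

/-- Tanaka's formula for the expected local time. -/
theorem two_mul_wordAvg_occ (t : ℕ) (z y : ℤ) :
    2 * wordAvg (L ⊕ Bool) t (fun w => (occ z y w : ℝ)) = Fintype.card L *
      (wordAvg (L ⊕ Bool) t (fun w => |((endPos y w - z : ℤ) : ℝ)|) - |((y - z : ℤ) : ℝ)|) := by
  induction t generalizing y with
  | zero => simp [endPos]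
  | succ t ih =>
    have h1 := ih y
    have h2 := ih (y + 1)
    have h3 := ih (y + -1)
    have h4 := abs_add_one_add_abs_sub_one (y - z)
    have e1 : ((y + 1 - z : ℤ) : ℝ) = ((y - z : ℤ) : ℝ) + 1 := by push_cast; ring
    have e2 : ((y + -1 - z : ℤ) : ℝ) = ((y - z : ℤ) : ℝ) - 1 := by push_cast; ring
    rw [e1] at h2
    rw [e2] at h3
    rw [wordAvg_sum_succ, wordAvg_sum_succ]
    simp only [occ_inl, occ_inr, endPos, boolStep, Nat.cast_add, wordAvg_add, Nat.cast_ite,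
      Nat.cast_one, Nat.cast_zero, wordAvg_const, Finset.sum_const, Finset.card_univ,
      nsmul_eq_mul, if_true, Bool.false_eq_true, if_false]
    simp only [sub_eq_zero] at h4
    set q : ℝ := (Fintype.card L : ℝ)
    have hq : 0 ≤ q := Nat.cast_nonneg _
    rw [← mul_div_assoc, div_eq_iff (by positivity), mul_assoc q, sub_mul,
      div_mul_cancel₀ _ (by positivity)]
    by_cases hyz : y = z
    · simp only [hyz, if_true] at h1 h2 h3 h4 ⊢
      linear_combination q * h1 + h2 + h3 - q * h4
    · simp only [if_neg hyz] at h4 ⊢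
      linear_combination q * h1 + h2 + h3 - q * h4

theorem wordAvg_endPos_sq_le (t : ℕ) (z y : ℤ) :
    wordAvg (L ⊕ Bool) t (fun w => ((endPos y w - z : ℤ) : ℝ) ^ 2) ≤ ((y - z : ℤ) : ℝ) ^ 2 + t := by
  induction t generalizing y with
  | zero => simp [endPos]
  | succ t ih =>
    have h1 := ih y
    have h2 := ih (y + 1)
    have h3 := ih (y + -1)
    have e1 : ((y + 1 - z : ℤ) : ℝ) = ((y - z : ℤ) : ℝ) + 1 := by push_cast; ring
    have e2 : ((y + -1 - z : ℤ) : ℝ) = ((y - z : ℤ) : ℝ) - 1 := by push_cast; ring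
    rw [e1] at h2
    rw [e2] at h3
    rw [wordAvg_sum_succ]
    simp only [endPos, boolStep, Finset.sum_const, Finset.card_univ,
      nsmul_eq_mul, if_true, Bool.false_eq_true, if_false]
    set q : ℝ := (Fintype.card L : ℝ)
    have hq : 0 ≤ q := Nat.cast_nonneg _
    rw [div_le_iff₀ (by positivity)]
    push_cast at *
    nlinarith [mul_le_mul_of_nonneg_left h1 hq]

theorem wordAvg_occ_self_le (t : ℕ) (y : ℤ) :
    2 * wordAvg (L ⊕ Bool) t (fun w => (occ y y w : ℝ)) ≤ Fintype.card L * √t := by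
  rw [two_mul_wordAvg_occ]
  gcongr
  rw [sub_self, Int.cast_zero, abs_zero, sub_zero]
  refine Real.le_sqrt_of_sq_le ((wordAvg_sq_le _ _).trans ?_)
  simp only [sq_abs]
  simpa using wordAvg_endPos_sq_le (L := L) t y y

/-- A first lamp letter adds `2 * occ 0 0 w + 1`, of mean at most `|L|√t + 1`, so the energy is of
order `t^{3/2}`. -/
theorem wordAvg_energy_le (t : ℕ) :
    wordAvg (L ⊕ Bool) t (fun w => (energy w : ℝ)) ≤ t * (Fintype.card L * √t + 1) := by
  induction t with
  | zero => simp [energy]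
  | succ t ih =>
    rw [wordAvg_sum_succ]
    simp only [energy, Nat.cast_add, Nat.cast_mul, Nat.cast_ofNat, Nat.cast_one, wordAvg_add,
      wordAvg_mul_left, wordAvg_const, Finset.sum_const, Finset.card_univ, nsmul_eq_mul]
    have h1 := wordAvg_occ_self_le (L := L) t 0
    set q : ℝ := (Fintype.card L : ℝ)
    have hq : 0 ≤ q := Nat.cast_nonneg _
    set e := wordAvg (L ⊕ Bool) t fun w => (energy w : ℝ)
    set o := wordAvg (L ⊕ Bool) t fun w => (occ 0 0 w : ℝ)
    have h2 : √(t : ℝ) ≤ √((t : ℝ) + 1) := Real.sqrt_le_sqrt (by linarith)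
    have h3 : e ≤ t * (q * √((t : ℝ) + 1) + 1) := ih.trans (by gcongr)
    have h4 : 2 * o + 1 ≤ q * √((t : ℝ) + 1) + 1 := by nlinarith
    have h5 : 0 ≤ q * √((t : ℝ) + 1) + 1 := by positivity
    rw [div_le_iff₀ (by positivity)]
    nlinarith [mul_le_mul_of_nonneg_left h3 hq, mul_le_mul_of_nonneg_left h4 hq]

/-- Input for a Chebyshev bound on the lamp letters executed outside the window. -/
theorem wordAvg_lampSum_sq_le (t : ℕ) (y : ℤ) :
    wordAvg (L ⊕ Bool) t (fun w => lampSum (fun k => (k : ℝ) ^ 2) y w) ≤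
      t * (y : ℝ) ^ 2 + (t : ℝ) ^ 2 := by
  induction t generalizing y with
  | zero => simp [lampSum]
  | succ t ih =>
    have h1 := ih y
    have h2 := ih (y + 1)
    have h3 := ih (y + -1)
    rw [wordAvg_sum_succ]
    simp only [lampSum, boolStep, wordAvg_add, wordAvg_const, Finset.sum_const, Finset.card_univ,
      nsmul_eq_mul, if_true, Bool.false_eq_true, if_false]
    set q : ℝ := (Fintype.card L : ℝ)
    have hq : 0 ≤ q := Nat.cast_nonneg _
    rw [div_le_iff₀ (by positivity)]
    push_cast at *
    have ht : (0 : ℝ) ≤ t := Nat.cast_nonneg _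
    nlinarith [mul_le_mul_of_nonneg_left h1 hq, sq_nonneg (y : ℝ), mul_nonneg hq ht]

theorem wordAvg_lampSum_one (t : ℕ) (y : ℤ) :
    wordAvg (L ⊕ Bool) t (fun w => lampSum (fun _ => (1 : ℝ)) y w) =
      t * (Fintype.card L / (Fintype.card L + 2)) := by
  induction t generalizing y with
  | zero => simp [lampSum]
  | succ t ih =>
    rw [wordAvg_sum_succ]
    simp only [lampSum, wordAvg_add, wordAvg_const, Finset.sum_const, Finset.card_univ,
      nsmul_eq_mul, ih]
    push_cast
    field_simp
    ring

/-- The window containing most of the positions visited up to time `t`. -/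
noncomputable def window (t : ℕ) : Finset ℤ :=
  Finset.Icc (-(⌈3 * √(t : ℝ)⌉₊ : ℤ)) ⌈3 * √(t : ℝ)⌉₊

theorem card_window_le {t : ℕ} (ht : 1 ≤ t) : ((window t).card : ℝ) ≤ 9 * √t := by
  have h1 : (1 : ℝ) ≤ √t := Real.one_le_sqrt.2 (by exact_mod_cast ht)
  have h2 : (⌈3 * √(t : ℝ)⌉₊ : ℝ) < 3 * √t + 1 := Nat.ceil_lt_add_one (by positivity)
  have h3 : ((window t).card : ℝ) = 2 * ⌈3 * √(t : ℝ)⌉₊ + 1 := by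
    rw [window, Int.card_Icc]
    have : ((⌈3 * √(t : ℝ)⌉₊ : ℤ) + 1 - -(⌈3 * √(t : ℝ)⌉₊ : ℤ)).toNat =
        2 * ⌈3 * √(t : ℝ)⌉₊ + 1 := by omega
    rw [this]
    push_cast
    rfl
  linarith

/-- At least `t/3` lamp letters are expected. Outside the window `k² ≥ 9t`, so at most `t²/(9t) =
t/9` of them are expected there, which leaves `2t/9`. -/
theorem le_wordAvg_sum_occ [Nonempty L] {t : ℕ} (ht : 1 ≤ t) :
    2 / 9 * (t : ℝ) ≤ wordAvg (L ⊕ Bool) t (fun w => ∑ z ∈ window t, (occ z 0 w : ℝ)) := by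
  have ht0 : (0 : ℝ) < t := by exact_mod_cast ht
  have h1 := wordAvg_lampSum_one (L := L) t 0
  have h2 := wordAvg_lampSum_sq_le (L := L) t 0
  have hq : (1 : ℝ) ≤ Fintype.card L := by exact_mod_cast Fintype.card_pos (α := L)
  have h3 : 1 / 3 ≤ (Fintype.card L : ℝ) / (Fintype.card L + 2) := by
    rw [div_le_div_iff₀ (by norm_num) (by positivity)]
    linarith
  have hs : 9 * (t : ℝ) ≤ (⌈3 * √(t : ℝ)⌉₊ : ℝ) ^ 2 := by
    have := Nat.le_ceil (3 * √(t : ℝ))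
    calc 9 * (t : ℝ) = (3 * √t) ^ 2 := by rw [mul_pow, Real.sq_sqrt ht0.le]; norm_num
      _ ≤ _ := by gcongr
  have h4 : wordAvg (L ⊕ Bool) t (fun w => lampSum (fun _ => (1 : ℝ)) 0 w) ≤
      wordAvg (L ⊕ Bool) t (fun w => (∑ z ∈ window t, (occ z 0 w : ℝ)) +
        1 / (9 * t) * lampSum (fun k => (k : ℝ) ^ 2) 0 w) := by
    refine wordAvg_mono fun w _ => ?_
    rw [sum_occ, ← lampSum_add_mul]
    refine lampSum_mono (fun k => ?_) 0 w
    split_ifs with hk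
    · have : 0 ≤ 1 / (9 * (t : ℝ)) * (k : ℝ) ^ 2 := by positivity
      linarith
    · rw [zero_add, one_div, inv_mul_eq_div, one_le_div (by positivity)]
      refine hs.trans ?_
      have hk' : (⌈3 * √(t : ℝ)⌉₊ : ℤ) ≤ |k| := by
        by_contra hcon
        rw [window, Finset.mem_Icc, ← abs_le] at hk
        omega
      rw [← sq_abs (k : ℝ)]
      gcongr
      exact_mod_cast hk'
  rw [wordAvg_add, wordAvg_mul_left, h1] at h4
  have h5 : 1 / (9 * (t : ℝ)) * wordAvg (L ⊕ Bool) t (fun w => lampSum (fun k => (k : ℝ) ^ 2) 0 w) ≤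
      t / 9 := by
    rw [one_div, inv_mul_le_iff₀ (by positivity)]
    simp only [Int.cast_zero] at h2
    nlinarith
  nlinarith

/-- The sites of the window at which many lamp letters are executed. -/
noncomputable def heavySites (t : ℕ) (w : List (L ⊕ Bool)) : Finset ℤ :=
  (window t).filter fun z => √t / 162 ≤ (occ z 0 w : ℝ)

/-- The expected number of heavy sites is of order `√t`. -/
theorem le_wordAvg_card_heavySites [Nonempty L] {t : ℕ} (ht : 1 ≤ t) :
    √t / (36 * (Fintype.card L + 1)) ≤
      wordAvg (L ⊕ Bool) t (fun w => ((heavySites t w).card : ℝ)) := by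
  have ht0 : (0 : ℝ) < t := by exact_mod_cast ht
  have hs1 : (1 : ℝ) ≤ √t := Real.one_le_sqrt.2 (by exact_mod_cast ht)
  have hss : √(t : ℝ) * √t = t := Real.mul_self_sqrt ht0.le
  -- Heavy sites are bounded by Cauchy-Schwarz against the energy. Light ones contribute at most
  -- `9√t * √t/162 = t/18`, which explains the threshold `162`.
  have h1 : wordAvg (L ⊕ Bool) t (fun w => ∑ z ∈ window t, (occ z 0 w : ℝ)) ≤
      wordAvg (L ⊕ Bool) t (fun w => (√(heavySites t w).card * √(energy w)) + t / 18) := by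
    refine wordAvg_mono fun w _ => ?_
    rw [← Finset.sum_filter_add_sum_filter_not (window t) (fun z => √t / 162 ≤ (occ z 0 w : ℝ))]
    refine add_le_add ?_ ?_
    · rw [← Real.sqrt_mul (by positivity)]
      refine Real.le_sqrt_of_sq_le (sq_sum_le_card_mul_sum_sq.trans ?_)
      refine mul_le_mul_of_nonneg_left ?_ (by positivity)
      exact_mod_cast sum_occ_sq_le_energy _ 0 w
    · calc _ ≤ ∑ z ∈ (window t).filter (fun z => ¬ √t / 162 ≤ (occ z 0 w : ℝ)), √(t : ℝ) / 162 :=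
            Finset.sum_le_sum fun z hz => (not_le.1 (Finset.mem_filter.1 hz).2).le
        _ ≤ (window t).card * (√(t : ℝ) / 162) := by
            rw [Finset.sum_const, nsmul_eq_mul]
            gcongr
            exact Finset.filter_subset _ _
        _ ≤ 9 * √t * (√(t : ℝ) / 162) := by
            gcongr
            exact card_window_le ht
        _ = √t * √t / 18 := by ring
        _ = t / 18 := by rw [hss]
  have h2 := le_wordAvg_sum_occ (L := L) ht
  rw [wordAvg_add, wordAvg_const] at h1
  have h3 := wordAvg_mul_sq_le t (fun w : List (L ⊕ Bool) => √((heavySites t w).card : ℝ))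
    (fun w => √(energy w : ℝ))
  simp only [Real.sq_sqrt (Nat.cast_nonneg _)] at h3
  have h4 := wordAvg_energy_le (L := L) t
  set q : ℝ := (Fintype.card L : ℝ)
  have hq : 0 ≤ q := Nat.cast_nonneg _
  set A := wordAvg (L ⊕ Bool) t (fun w => √((heavySites t w).card : ℝ) * √(energy w : ℝ))
  set N := wordAvg (L ⊕ Bool) t (fun w => ((heavySites t w).card : ℝ))
  have hN0 : 0 ≤ N := by
    simp only [N, wordAvg_eq_sum]
    positivity
  -- `2/9 - 1/18 = 1/6`; a second Cauchy-Schwarz, over words, then compares `A²` with `N` times the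
  -- mean energy.
  have hA : t / 6 ≤ A := by linarith
  have h5 : (t / 6 : ℝ) ^ 2 ≤ N * (t * ((q + 1) * √t)) := by
    calc (t / 6 : ℝ) ^ 2 ≤ A ^ 2 := by gcongr
      _ ≤ _ := h3
      _ ≤ N * (t * (q * √t + 1)) := by gcongr
      _ ≤ _ := by gcongr; linarith
  rw [div_le_iff₀ (by positivity)]
  have h6 : (t * √t : ℝ) * √t ≤ (t * √t) * (N * (36 * (q + 1))) := by
    rw [mul_assoc, hss]
    nlinarith
  exact le_of_mul_le_mul_left h6 (by positivity)

end LocalTime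

end HilbertCompression

namespace HilbertCompression

/-! ### Speed of the random walk on `G ≀ ℤ` and on `ℤ`. -/

section Escape

namespace ZWreath

variable {G : Type} [Group G] {S : Finset G} {L : Type*}

/-- The lamp at `z` after the lamplighter, started at `y`, executes a word. -/
def lampAt (v : L → G) (z : ℤ) : ℤ → List (L ⊕ Bool) → G
  | _, [] => 1
  | y, Sum.inl a :: w => (if y = z then v a else 1) * lampAt v z y w
  | y, Sum.inr b :: w => lampAt v z (y + boolStep b) w

/-- The generator coded by a letter. -/
def letter (v : L → G) : L ⊕ Bool → ZWreath G
  | Sum.inl a => lampGen (v a)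
  | Sum.inr b => shift G (boolStep b)

theorem lamps_prod_letter (v : L → G) (z y : ℤ) (w : List (L ⊕ Bool)) :
    lamps (w.map (letter v)).prod (z - y) = lampAt v z y w := by
  induction w generalizing y with
  | nil => rfl
  | cons a w ih =>
    rw [List.map_cons, List.prod_cons, lamps_mul]
    rcases a with a | b
    · simp only [letter, lamps_lampGen, pos_lampGen, lampAt, sub_zero, ih, sub_eq_zero,
        eq_comm (a := z)]
    · simp only [letter, lamps_shift, pos_shift, lampAt, one_mul, ← ih, sub_sub]

/-- Given the number of visits, the lamp at `z` is distributed like a random walk on `G`. -/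
theorem wordAvg_occ_lampAt [Fintype L] [Nonempty L] (v : L → G) (t : ℕ) (z y : ℤ)
    (H : ℕ → G → ℝ) :
    wordAvg (L ⊕ Bool) t (fun w => H (occ z y w) (lampAt v z y w)) =
      wordAvg (L ⊕ Bool) t (fun w =>
        wordAvg L (occ z y w) fun l => H (occ z y w) (l.map v).prod) := by
  induction t generalizing y H with
  | zero => simp [lampAt]
  | succ t ih =>
    have hq : (Fintype.card L : ℝ) ≠ 0 := by exact_mod_cast Fintype.card_ne_zero
    rw [wordAvg_sum_succ, wordAvg_sum_succ]
    simp only [occ_inr, lampAt, ih (_ + _), occ_inl]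
    congr 2
    by_cases hyz : y = z
    · simp only [hyz, if_true]
      rw [Finset.sum_const, Finset.card_univ, nsmul_eq_mul]
      simp only [add_comm 1 (occ _ _ _), wordAvg_succ, wordAvg_div, wordAvg_sum]
      rw [mul_div_cancel₀ _ hq]
      refine Finset.sum_congr rfl fun a _ => ?_
      -- The letter just executed at `z` becomes the first step of the lamp's walk; absorbing it
      -- into `H` is why `H` is kept general.
      rw [ih z fun n g => H (n + 1) (v a * g)]
      simp
    · simp only [hyz, if_false, zero_add, one_mul, ih y]

/-- The letters enumerate the generators without repetition. -/
noncomputable def letterEquiv (S : Finset G) : S ⊕ Bool ≃ gens S :=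
  Equiv.ofBijective (fun a => ⟨letter (fun s : S => (s : G)) a, by
    rw [mem_gens]
    rcases a with a | b
    · exact Or.inl ⟨a, a.2, rfl⟩
    · rcases b with _ | _
      · exact Or.inr (Or.inr rfl)
      · exact Or.inr (Or.inl rfl)⟩) (by
    constructor
    · intro a b h
      have h' := congrArg Subtype.val h
      have hp := congrArg pos h'
      rcases a with a | a <;> rcases b with b | b
      · exact congrArg Sum.inl (Subtype.ext (lampGen_injective h'))
      · cases b <;> simp [letter, boolStep] at hp
      · cases a <;> simp [letter, boolStep] at hp
      · cases a <;> cases b <;> simp [letter, boolStep] at hp ⊢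
    · rintro ⟨x, hx⟩
      rcases mem_gens.1 hx with ⟨g, hg, rfl⟩ | rfl | rfl
      · exact ⟨Sum.inl ⟨g, hg⟩, rfl⟩
      · exact ⟨Sum.inr true, rfl⟩
      · exact ⟨Sum.inr false, rfl⟩)

open Classical in
theorem walkProb_gens (S : Finset G) (t : ℕ) (E : Set (ZWreath G)) :
    walkProb (gens S) t E = wordAvg (S ⊕ Bool) t fun w =>
      if (w.map (letter fun s : S => (s : G))).prod ∈ E then 1 else 0 := by
  rw [walkProb_eq_wordAvg, ← wordAvg_map_equiv (letterEquiv S)]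
  congr 1
  ext w
  rw [List.map_map]
  rfl

open Classical in
/-- The speed of the random walk on a wreath product with `ℤ`. -/
theorem hasEscapeEstimate_gens (hS : IsSymmGenerating S) (hne : S.Nonempty) {β : ℝ} (hβ : 0 ≤ β)
    (h : HasEscapeEstimate S β) : HasEscapeEstimate (gens S) ((1 + β) / 2) := by
  obtain ⟨c, δ, hc, hδ, hesc⟩ := h
  have : Nonempty S := hne.to_subtype
  set v : S → G := fun s => (s : G)
  set κ : ℝ := 1 / (36 * (Fintype.card S + 1)) with hκ
  have hκ0 : 0 < κ := by positivity
  refine ⟨δ * κ / 2 * (c * (1 / 162) ^ β), min (δ * κ / 18) 1, by positivity, by positivity,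
    fun t => ?_⟩
  rcases Nat.eq_zero_or_pos t with rfl | ht
  · rw [walkProb_gens, wordAvg_zero, if_pos]
    · exact min_le_right _ _
    · have h0 : (1 + β) / 2 ≠ 0 := by positivity
      simp [Real.zero_rpow h0]
  have ht0 : (0 : ℝ) < t := by exact_mod_cast ht
  have hst : 0 < √(t : ℝ) := Real.sqrt_pos.2 ht0
  set m : ℝ := √t / 162 with hm
  have hm0 : 0 < m := by positivity
  -- `Y` counts the sites that are heavy and whose lamp has escaped. Its mean is at least `δκ√t` and
  -- it never exceeds `9√t`, so `Y ≥ δκ√t/2` with probability at least `δκ/18`.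
  set Y : List (S ⊕ Bool) → ℝ := fun w => ∑ z ∈ window t,
    if m ≤ (occ z 0 w : ℝ) ∧ c * m ^ β ≤ wordDist S 1 (lampAt v z 0 w) then 1 else 0 with hY
  have hYle : ∀ w, w.length = t → Y w ≤ 9 * √t := by
    intro w _
    refine le_trans ?_ (card_window_le ht)
    calc Y w ≤ ∑ z ∈ window t, (1 : ℝ) :=
          Finset.sum_le_sum fun z _ => by split_ifs <;> norm_num
      _ = _ := by simp
  have hYavg : 2 * (δ * κ / 2 * √t) ≤ wordAvg (S ⊕ Bool) t Y := by
    have h1 := le_wordAvg_card_heavySites (L := S) ht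
    have h2 : δ * wordAvg (S ⊕ Bool) t (fun w => ((heavySites t w).card : ℝ)) ≤
        wordAvg (S ⊕ Bool) t Y := by
      simp only [heavySites, Finset.card_filter, Nat.cast_sum, hY]
      rw [wordAvg_sum, wordAvg_sum, Finset.mul_sum]
      refine Finset.sum_le_sum fun z _ => ?_
      rw [wordAvg_occ_lampAt v t z 0 (fun n g => if m ≤ (n : ℝ) ∧ c * m ^ β ≤ wordDist S 1 g
        then 1 else 0), ← wordAvg_mul_left]
      refine wordAvg_mono fun w _ => ?_
      by_cases hw : m ≤ (occ z 0 w : ℝ)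
      · simp only [hm.symm, hw, if_true, true_and, Nat.cast_one, mul_one]
        -- The escape estimate of `G` is used at the random time `occ z 0 w ≥ m`; since `β ≥ 0` its
        -- bound is at least `c * m ^ β`.
        refine (hesc (occ z 0 w)).trans ?_
        rw [walkProb_eq_wordAvg]
        refine wordAvg_mono fun l _ => ?_
        split_ifs with h1 h2 h2
        · exact le_rfl
        · rw [Set.mem_ofPred_eq, hS.wordDist_one_right] at h1
          refine absurd (le_trans ?_ h1) h2
          gcongr
        · exact zero_le_one
        · exact le_rfl
      · simp [hm.symm, hw, wordAvg_const]
    have h3 : √t / (36 * ((Fintype.card S : ℝ) + 1)) = κ * √t := by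
      rw [hκ]
      ring
    rw [h3] at h1
    have := mul_le_mul_of_nonneg_left h1 hδ.le
    linarith
  have hprob := le_wordAvg_indicator t Y (by positivity) hYle hYavg (by positivity)
  refine (min_le_left _ _).trans ?_
  have e1 : δ * κ / 2 * √t / (9 * √t) = δ * κ / 18 := by
    field_simp
    norm_num
  rw [e1] at hprob
  refine hprob.trans ?_
  rw [walkProb_gens]
  refine wordAvg_mono fun w _ => ?_
  split_ifs with h1 h2 h2
  · exact le_rfl
  · refine absurd ?_ h2
    rw [Set.mem_ofPred_eq, (isSymmGenerating_gens hS).wordDist_one_right]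
    have h3 : Y w * (c * m ^ β) ≤ ∑ z ∈ window t, (wordDist S 1 (lampAt v z 0 w) : ℝ) := by
      rw [hY, Finset.sum_mul]
      refine Finset.sum_le_sum fun z _ => ?_
      split_ifs with hz
      · rw [one_mul]
        exact hz.2
      · simp
    have h4 : ∑ z ∈ window t, (wordDist S 1 (lampAt v z 0 w) : ℝ) ≤
        (wordDist (gens S) 1 (w.map (letter v)).prod : ℝ) := by
      have := sum_wordDist_lamps_le hS (window t) (w.map (letter v)).prod
      have e : ∀ z, lamps (w.map (letter v)).prod z = lampAt v z 0 w := fun z => by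
        rw [← lamps_prod_letter, sub_zero]
      simp only [e] at this
      exact_mod_cast this
    refine le_trans ?_ (h3.trans h4)
    calc δ * κ / 2 * (c * (1 / 162) ^ β) * (t : ℝ) ^ ((1 + β) / 2)
        = δ * κ / 2 * √t * (c * m ^ β) := by
          rw [hm, div_eq_mul_one_div (√(t : ℝ)), Real.mul_rpow hst.le (by norm_num),
            Real.sqrt_eq_rpow, ← Real.rpow_mul ht0.le,
            show (1 + β) / 2 = 1 / 2 + 1 / 2 * β by ring, Real.rpow_add ht0]
          ring
      _ ≤ _ := by gcongr
  · exact zero_le_one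
  · exact le_rfl

end ZWreath

/-- The standard generators of `ℤ`. -/
def intGens : Finset (Multiplicative ℤ) := {Multiplicative.ofAdd 1, Multiplicative.ofAdd (-1)}

theorem isSymmGenerating_intGens : IsSymmGenerating intGens := by
  constructor
  · intro s hs
    simp only [intGens, Finset.mem_insert, Finset.mem_singleton] at hs ⊢
    rcases hs with rfl | rfl
    exacts [Or.inr rfl, Or.inl rfl]
  · rw [eq_top_iff]
    intro x _
    have h1 : Multiplicative.ofAdd (1 : ℤ) ∈ Subgroup.closure (intGens : Set (Multiplicative ℤ)) :=
      Subgroup.subset_closure (by simp [intGens])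
    have := Subgroup.zpow_mem _ h1 x.toAdd
    rwa [← ofAdd_zsmul, smul_eq_mul, mul_one] at this

theorem wordAvg_intGens_succ (t : ℕ) (φ : ℤ → ℝ) (y : ℤ) :
    wordAvg intGens (t + 1) (fun l => φ (y + (l.map Subtype.val).prod.toAdd)) =
      (wordAvg intGens t (fun l => φ (y + 1 + (l.map Subtype.val).prod.toAdd)) +
        wordAvg intGens t (fun l => φ (y + -1 + (l.map Subtype.val).prod.toAdd))) / 2 := by
  rw [wordAvg_succ]
  simp only [List.map_cons, List.prod_cons, toAdd_mul, ← add_assoc]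
  rw [Finset.sum_coe_sort intGens
    (fun s => wordAvg intGens t (fun l => φ (y + s.toAdd + (l.map Subtype.val).prod.toAdd)))]
  have h : Multiplicative.ofAdd (1 : ℤ) ≠ Multiplicative.ofAdd (-1) := by decide
  rw [Fintype.card_coe]
  have hc : intGens.card = 2 := Finset.card_pair h
  rw [hc, intGens, Finset.sum_pair h]
  rfl

theorem wordAvg_intGens_sq (t : ℕ) (y : ℤ) :
    wordAvg intGens t (fun l => ((y + (l.map Subtype.val).prod.toAdd : ℤ) : ℝ) ^ 2) = (y : ℝ) ^ 2 + t := by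
  induction t generalizing y with
  | zero => simp
  | succ t ih =>
    rw [wordAvg_intGens_succ t (fun k => (k : ℝ) ^ 2), ih, ih]
    push_cast
    ring

theorem wordAvg_intGens_pow_four (t : ℕ) (y : ℤ) :
    wordAvg intGens t (fun l => ((y + (l.map Subtype.val).prod.toAdd : ℤ) : ℝ) ^ 4) =
      (y : ℝ) ^ 4 + 6 * y ^ 2 * t + 3 * t ^ 2 - 2 * t := by
  induction t generalizing y with
  | zero => simp
  | succ t ih =>
    rw [wordAvg_intGens_succ t (fun k => (k : ℝ) ^ 4), ih, ih]
    push_cast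
    ring

theorem natAbs_le_wordDist_intGens (x : Multiplicative ℤ) :
    x.toAdd.natAbs ≤ wordDist intGens 1 x := by
  refine isSymmGenerating_intGens.le_wordDist_one (fun x => x.toAdd.natAbs) rfl ?_ x
  intro g s hs
  simp only [intGens, Finset.mem_insert, Finset.mem_singleton] at hs
  rcases hs with rfl | rfl <;> simp only [toAdd_mul, toAdd_ofAdd] <;> omega

-- A second moment argument: `E X² = t` and `E X⁴ ≤ 3t²`. The event `|X| ≥ √t/2` carries at least
-- `3t/4` of `E X²`, and Cauchy-Schwarz against the fourth moment bounds its probability below by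
-- `3/16`.
open Classical in
theorem hasEscapeEstimate_intGens : HasEscapeEstimate intGens (1 / 2) := by
  have hne : Nonempty intGens := ⟨⟨Multiplicative.ofAdd 1, by simp [intGens]⟩⟩
  refine ⟨1 / 2, 1 / 12, by norm_num, by norm_num, fun t => ?_⟩
  rw [walkProb_eq_wordAvg]
  rcases Nat.eq_zero_or_pos t with rfl | ht
  · rw [wordAvg_zero, if_pos (by simp)]
    norm_num
  have ht0 : (0 : ℝ) < t := by exact_mod_cast ht
  set X : List intGens → ℝ := fun l => ((0 + (l.map Subtype.val).prod.toAdd : ℤ) : ℝ) with hX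
  set I : List intGens → ℝ := fun l => if 1 / 2 * √t ≤ |X l| then 1 else 0 with hI
  have h2 : wordAvg intGens t (fun l => X l ^ 2) = t := by
    exact (wordAvg_intGens_sq t 0).trans (by simp)
  have h4 : wordAvg intGens t (fun l => (X l ^ 2) ^ 2) = 3 * t ^ 2 - 2 * t := by
    simp only [← pow_mul]
    exact (wordAvg_intGens_pow_four t 0).trans (by simp)
  have h5 : wordAvg intGens t (fun l => X l ^ 2) ≤
      wordAvg intGens t (fun l => X l ^ 2 * I l + t / 4) := by
    refine wordAvg_mono fun l _ => ?_
    simp only [hI]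
    split_ifs with h
    · linarith
    · rw [mul_zero, zero_add, ← sq_abs]
      calc |X l| ^ 2 ≤ (1 / 2 * √t) ^ 2 := by
            refine pow_le_pow_left₀ (abs_nonneg _) (not_le.1 h).le 2
        _ = (t : ℝ) / 4 := by
            rw [mul_pow, Real.sq_sqrt ht0.le]
            ring
  rw [wordAvg_add, wordAvg_const, h2] at h5
  have h6 := wordAvg_mul_sq_le t (fun l => X l ^ 2) I
  rw [h4] at h6
  have hII : ∀ l, I l ^ 2 = I l := fun l => by simp only [hI]; split_ifs <;> norm_num
  simp only [hII] at h6
  have h7 : (3 * t / 4 : ℝ) ^ 2 ≤ wordAvg intGens t (fun l => X l ^ 2 * I l) ^ 2 := by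
    gcongr
    linarith
  have hI0 : 0 ≤ wordAvg intGens t I := by
    rw [wordAvg_eq_sum]
    refine div_nonneg (Finset.sum_nonneg fun l _ => ?_) (by positivity)
    simp only [hI]
    split_ifs <;> norm_num
  have h8 : 1 / 12 ≤ wordAvg intGens t I := by
    by_contra hcon
    push Not at hcon
    nlinarith [mul_pos ht0 ht0]
  refine h8.trans (wordAvg_mono fun l _ => ?_)
  simp only [hI]
  split_ifs with h h' h'
  · exact le_rfl
  · refine absurd ?_ h'
    rw [Set.mem_ofPred_eq, isSymmGenerating_intGens.wordDist_one_right, ← Real.sqrt_eq_rpow]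
    refine h.trans ?_
    have := natAbs_le_wordDist_intGens (l.map Subtype.val).prod
    rw [hX]
    simp only [zero_add]
    rw [← Int.cast_abs, ← Nat.cast_natAbs]
    exact_mod_cast this
  · exact zero_le_one
  · exact le_rfl

end Escape

end HilbertCompression

namespace HilbertCompression

/-! ### Amenability of `ℤ` and of wreath products with `ℤ`. -/

section Folner

/-- Any finite set of integers almost preserves a long interval. -/
theorem exists_interval (T : ℕ) {ε : ℝ} (hε : 0 < ε) :
    ∃ N : ℕ, 0 < N ∧ (1 - ε) * (N : ℝ) ≤ ((N - T - T : ℕ) : ℝ) := by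
  obtain ⟨N, hN⟩ := exists_nat_ge (2 * T / ε + 1)
  have h0 : 0 ≤ 2 * T / ε := by positivity
  refine ⟨N, by exact_mod_cast (show (0 : ℝ) < N by linarith), ?_⟩
  have h1 : 2 * (T : ℝ) ≤ N * ε := by
    rw [← div_le_iff₀ hε]
    linarith
  have h2 : (N : ℝ) ≤ ((N - T - T : ℕ) : ℝ) + 2 * T := by
    have : N ≤ N - T - T + 2 * T := by omega
    exact_mod_cast this
  linarith

theorem isFolner_int : IsFolner (Multiplicative ℤ) := by
  classical
  intro B ε hε
  set T := B.sup fun b => b.toAdd.natAbs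
  obtain ⟨N, hN, h⟩ := exists_interval T hε
  have hinj : Function.Injective fun n : ℕ => Multiplicative.ofAdd (n : ℤ) := fun a b h => by
    exact_mod_cast Multiplicative.ofAdd.injective h
  refine ⟨(Finset.range N).image fun n : ℕ => Multiplicative.ofAdd (n : ℤ), ?_, ?_⟩
  · exact (Finset.nonempty_range_iff.2 hN.ne').image _
  · rw [Finset.card_image_of_injective _ hinj, Finset.card_range]
    refine h.trans ?_
    rw [Nat.cast_le, Nat.sub_right_comm, Nat.sub_right_comm, ← Nat.card_Ico T (N - T),
      ← Finset.card_image_of_injective _ hinj]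
    refine Finset.card_le_card fun x hx => ?_
    obtain ⟨n, hn, rfl⟩ := Finset.mem_image.1 hx
    rw [Finset.mem_Ico] at hn
    refine mem_stableCore.2 ⟨Finset.mem_image.2 ⟨n, Finset.mem_range.2 (by omega), rfl⟩,
      fun b hb => ?_⟩
    have hb' : b.toAdd.natAbs ≤ T := Finset.le_sup (f := fun b : Multiplicative ℤ =>
      b.toAdd.natAbs) hb
    refine Finset.mem_image.2 ⟨(n + b.toAdd).toNat, Finset.mem_range.2 (by omega), ?_⟩
    rw [Int.toNat_of_nonneg (by omega), ofAdd_add, ofAdd_toAdd]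

namespace ZWreath

variable {G : Type} [Group G]

/-- The element of `G ≀ ℤ` with lamps `p` on `[0, N)` and position `i`. -/
def ofFin {N : ℕ} (a : (Fin N → G) × ℕ) : ZWreath G :=
  mk (fun z => if h : 0 ≤ z ∧ z < N then a.1 ⟨z.toNat, by omega⟩ else 1)
    ((Set.finite_Ico (0 : ℤ) N).subset fun z hz => by
      by_contra h
      exact hz (dif_neg h)) a.2

theorem ofFin_injective (N : ℕ) : Function.Injective (ofFin : (Fin N → G) × ℕ → ZWreath G) := by
  intro a b h
  refine Prod.ext (funext fun j => ?_) ?_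
  · have := congrArg (fun x => lamps x (j : ℕ)) h
    simpa [ofFin] using this
  · have := congrArg pos h
    simpa [ofFin] using this

open Classical in
theorem mem_image_ofFin {N : ℕ} {F : Finset G} {x : ZWreath G} (h1 : 0 ≤ pos x) (h2 : pos x < N)
    (h3 : ∀ z : ℤ, 0 ≤ z → z < N → lamps x z ∈ F)
    (h4 : ∀ z : ℤ, ¬ (0 ≤ z ∧ z < N) → lamps x z = 1) :
    x ∈ ((Fintype.piFinset fun _ : Fin N => F) ×ˢ Finset.range N).image ofFin := by
  refine Finset.mem_image.2 ⟨(fun j => lamps x (j : ℕ), (pos x).toNat), ?_, ?_⟩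
  · rw [Finset.mem_product, Fintype.mem_piFinset, Finset.mem_range]
    exact ⟨fun j => h3 _ (by omega) (by exact_mod_cast j.2), by simp only; omega⟩
  · refine ext ?_ ?_
    · ext z
      simp only [ofFin, lamps_mk]
      split_ifs with h
      · congr 1
        omega
      · exact (h4 z h).symm
    · simp only [ofFin, pos_mk]
      omega

/-- The set consists of the elements with position in `[0, N)` and lamps in a Følner set `A` of `G`
on `[0, N)`, trivial elsewhere. An element lies in the core once its position is `T` away from the
ends and all its `N` lamps lie in the core of `A`. -/
theorem isFolner (hG : IsFolner G) : IsFolner (ZWreath G) := by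
  classical
  suffices key : ∀ (B : Finset (ZWreath G)) (ε : ℝ), 0 < ε → ε ≤ 1 → ∃ F : Finset (ZWreath G),
      F.Nonempty ∧ (1 - ε) * (F.card : ℝ) ≤
        ((stableCore F B).card : ℝ) by
    intro B ε hε
    obtain ⟨F, hF, h⟩ := key B (min ε 1) (lt_min hε one_pos) (min_le_right _ _)
    refine ⟨F, hF, le_trans ?_ h⟩
    gcongr
    exact min_le_left _ _
  intro B ε hε hε1
  obtain ⟨T, hT⟩ : ∃ T : ℕ, ∀ b ∈ B, (pos b).natAbs ≤ T ∧
      ∀ z, lamps b z ≠ 1 → z.natAbs ≤ T := by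
    have h : ∀ b : ZWreath G, ∃ T : ℕ, (pos b).natAbs ≤ T ∧
        ∀ z, lamps b z ≠ 1 → z.natAbs ≤ T := by
      intro b
      obtain ⟨R, hR, -⟩ := exists_support_radius b
      exact ⟨max (pos b).natAbs R, le_max_left _ _, fun z hz => (hR z hz).trans (le_max_right _ _)⟩
    choose T hT using h
    exact ⟨B.sup T, fun b hb => ⟨(hT b).1.trans (Finset.le_sup hb), fun z hz =>
      ((hT b).2 z hz).trans (Finset.le_sup hb)⟩⟩
  obtain ⟨N, hN, hNT⟩ := exists_interval T (half_pos hε)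
  have hN0 : (0 : ℝ) < N := by exact_mod_cast hN
  have hN1 : (1 : ℝ) ≤ N := by exact_mod_cast hN
  -- `N` is fixed before `A`, so `A` can be good enough for all `N` lamps at once: `(1 - η)^N ≥ 1 -
  -- ε/2` by Bernoulli.
  set η : ℝ := ε / 2 / N with hη
  have hη0 : 0 < η := by positivity
  have hη1 : η ≤ 1 := by
    rw [hη, div_le_one hN0]
    linarith
  obtain ⟨A, hA, hA'⟩ := hG ((B ×ˢ Finset.Icc (-(T : ℤ)) T).image fun a => lamps a.1 a.2) η hη0
  set I := stableCore A ((B ×ˢ Finset.Icc (-(T : ℤ)) T).image fun a => lamps a.1 a.2) with hI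
  set F : Finset (ZWreath G) :=
    ((Fintype.piFinset fun _ : Fin N => A) ×ˢ Finset.range N).image ofFin with hF
  refine ⟨F, ?_, ?_⟩
  · exact ((Fintype.piFinset_nonempty.2 fun _ => hA).product
      (Finset.nonempty_range_iff.2 hN.ne')).image _
  have hFcard : (F.card : ℝ) = (A.card : ℝ) ^ N * N := by
    rw [hF, Finset.card_image_of_injective _ (ofFin_injective N), Finset.card_product,
      Fintype.card_piFinset_const, Finset.card_range]
    push_cast
    rfl
  have hgood : ((Fintype.piFinset fun _ : Fin N => I) ×ˢ Finset.Ico T (N - T)).image ofFin ⊆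
      stableCore F B := by
    intro x hx
    obtain ⟨⟨p, i⟩, hpi, rfl⟩ := Finset.mem_image.1 hx
    rw [Finset.mem_product, Fintype.mem_piFinset, Finset.mem_Ico] at hpi
    obtain ⟨hp, hi⟩ := hpi
    simp only at hp hi
    refine mem_stableCore.2 ⟨Finset.mem_image_of_mem _ (Finset.mem_product.2
      ⟨Fintype.mem_piFinset.2 fun j => (mem_stableCore.1 (hp j)).1,
        Finset.mem_range.2 (by simp only; omega)⟩), fun b hb => ?_⟩
    obtain ⟨hb1, hb2⟩ := hT b hb
    refine mem_image_ofFin ?_ ?_ ?_ ?_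
    · simp only [pos_mul, ofFin, pos_mk]
      omega
    · simp only [pos_mul, ofFin, pos_mk]
      omega
    · intro z hz0 hzN
      rw [lamps_mul]
      simp only [ofFin, lamps_mk, pos_mk]
      rw [dif_pos ⟨hz0, hzN⟩]
      have hpz := mem_stableCore.1 (hp ⟨z.toNat, by omega⟩)
      by_cases hz : lamps b (z - i) = 1
      · rw [hz, mul_one]
        exact hpz.1
      · have := hb2 _ hz
        exact hpz.2 _ (Finset.mem_image.2 ⟨(b, z - i), Finset.mem_product.2
          ⟨hb, Finset.mem_Icc.2 (by simp only; omega)⟩, rfl⟩)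
    · intro z hz
      rw [lamps_mul]
      simp only [ofFin, lamps_mk, pos_mk]
      rw [dif_neg hz, one_mul]
      by_contra hcon
      have := hb2 _ hcon
      omega
  have hcard := Finset.card_le_card hgood
  rw [Finset.card_image_of_injective _ (ofFin_injective N), Finset.card_product,
    Fintype.card_piFinset_const, Nat.card_Ico] at hcard
  refine le_trans ?_ (Nat.cast_le.2 hcard)
  push_cast
  rw [hFcard]
  have hpow : (1 - ε / 2) * (A.card : ℝ) ^ N ≤ (I.card : ℝ) ^ N := by
    have h1 := one_add_mul_le_pow (show -2 ≤ -η by linarith) N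
    have h2 : (1 : ℝ) + N * -η = 1 - ε / 2 := by
      rw [hη]
      field_simp
      ring
    rw [h2] at h1
    calc (1 - ε / 2) * (A.card : ℝ) ^ N ≤ (1 + -η) ^ N * (A.card : ℝ) ^ N := by gcongr
      _ = ((1 - η) * A.card) ^ N := by rw [mul_pow, sub_eq_add_neg]
      _ ≤ _ := by
        refine pow_le_pow_left₀ (mul_nonneg (by linarith) (Nat.cast_nonneg _)) ?_ N
        convert hA'
  calc (1 - ε) * ((A.card : ℝ) ^ N * N)
      ≤ ((1 - ε / 2) * (A.card : ℝ) ^ N) * ((1 - ε / 2) * N) := by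
        have : 0 ≤ (A.card : ℝ) ^ N * N := by positivity
        nlinarith [mul_nonneg (sq_nonneg ε) this]
    _ ≤ (I.card : ℝ) ^ N * ((N - T - T : ℕ) : ℝ) := by
        refine mul_le_mul hpow hNT (mul_nonneg (by linarith) hN0.le) (by positivity)

end ZWreath

end Folner

/-! ### The induction on the number of wreath products. -/

section Main

/-- A group with a random walk of speed exponent `β`, Følner sequences, and compression exponents
all the way up to `1 / (2 * β)`. -/
def HasSharpExponents (G : Type) [Group G] (β : ℝ) : Prop :=
  IsFolner G ∧ ∃ S : Finset G, IsSymmGenerating S ∧ S.Nonempty ∧ HasEscapeEstimate S β ∧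
    ∀ α : ℝ, 1 / 2 ≤ α → α < 1 / (2 * β) → α ∈ compressionExponents S

theorem wordDist_intGens_le (x : Multiplicative ℤ) : wordDist intGens 1 x ≤ x.toAdd.natAbs := by
  obtain ⟨e, he, hx⟩ : ∃ e ∈ intGens, x = e ^ x.toAdd.natAbs := by
    rcases Int.natAbs_eq x.toAdd with h | h
    · refine ⟨Multiplicative.ofAdd 1, by simp [intGens], ?_⟩
      rw [← ofAdd_nsmul, nsmul_eq_mul, mul_one, ← h]
      rfl
    · refine ⟨Multiplicative.ofAdd (-1), by simp [intGens], ?_⟩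
      rw [← ofAdd_nsmul, nsmul_eq_mul, mul_neg_one, ← h]
      rfl
  have := wordDist_le_length (S := intGens) (List.replicate x.toAdd.natAbs e)
    (fun s hs => by rwa [List.eq_of_mem_replicate hs])
  rwa [List.prod_replicate, ← hx, List.length_replicate] at this

theorem hasSharpExponents_int : HasSharpExponents (Multiplicative ℤ) (1 / 2) := by
  refine ⟨isFolner_int, intGens, isSymmGenerating_intGens, by simp [intGens],
    hasEscapeEstimate_intGens, fun α h1 h2 => ?_⟩
  refine isSymmGenerating_intGens.mem_compressionExponents isSymmGenerating_intGens
    (fun x => (x.toAdd : ℝ)) (C := 1) (c := 1) (by linarith) ?_ one_pos ?_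
  · intro x s hs
    simp only [intGens, Finset.mem_insert, Finset.mem_singleton] at hs
    rcases hs with rfl | rfl <;> simp
  · intro x y hxy
    have hd : (1 : ℝ) ≤ wordDist intGens x y := by
      exact_mod_cast isSymmGenerating_intGens.wordDist_pos hxy
    have h3 := wordDist_intGens_le (x⁻¹ * y)
    rw [← wordDist_eq_one_left] at h3
    rw [one_mul, Real.norm_eq_abs, ← Int.cast_sub, ← Int.cast_abs, ← Nat.cast_natAbs]
    calc (wordDist intGens x y : ℝ) ^ α ≤ (wordDist intGens x y : ℝ) ^ (1 : ℝ) :=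
          Real.rpow_le_rpow_of_exponent_le hd (by norm_num at h2; linarith)
      _ = wordDist intGens x y := Real.rpow_one _
      _ ≤ ((x⁻¹ * y).toAdd.natAbs : ℝ) := by exact_mod_cast h3
      _ = _ := by
        rw [toAdd_mul, toAdd_inv, ← Int.natAbs_neg]
        congr 2
        ring

theorem HasSharpExponents.zwreath {G : Type} [Group G] {β : ℝ} (hβ : 0 < β)
    (h : HasSharpExponents G β) : HasSharpExponents (ZWreath G) ((1 + β) / 2) := by
  obtain ⟨hF, S, hS, hne, hesc, hcomp⟩ := h
  refine ⟨ZWreath.isFolner hF, ZWreath.gens S, ZWreath.isSymmGenerating_gens hS,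
    ⟨_, ZWreath.mem_gens.2 (Or.inr (Or.inl rfl))⟩,
    ZWreath.hasEscapeEstimate_gens hS hne hβ.le hesc, fun α' h1 h2 => ?_⟩
  -- Write `α' = θτ` with `θ = α'/τ < 1`. The exponent `α = τ/(2(1 - τ))` of `G` solves `2α/(2α + 1)
  -- = τ`, and `α < 1/(2β)` amounts to `τ(1 + β) < 1`.
  obtain ⟨τ, hτ1, hτ2⟩ := exists_between h2
  rw [mul_div_cancel₀ _ two_ne_zero, lt_div_iff₀ (by linarith)] at hτ2
  have hτ0 : 0 < τ := by linarith
  have hτ3 : τ < 1 := by nlinarith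
  have h1τ : 0 < 1 - τ := by linarith
  have e : α' / τ * (2 * (τ / (2 * (1 - τ))) / (2 * (τ / (2 * (1 - τ))) + 1)) = α' := by
    field_simp
    ring
  rw [← e]
  refine ZWreath.mul_mem_compressionExponents hS (hcomp _ ?_ ?_) ?_ ?_ ?_
  · rw [div_le_div_iff₀ (by norm_num) (by linarith)]
    linarith
  · rw [div_lt_div_iff₀ (by linarith) (by linarith)]
    nlinarith
  · rw [div_le_div_iff₀ (by norm_num) (by linarith)]
    linarith
  · rw [div_lt_div_iff₀ (by norm_num) hτ0]
    linarith
  · rw [div_lt_one hτ0]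
    exact hτ1

theorem HasSharpExponents.hilbertCompressionExponent_eq {G : Type} [Group G] {β : ℝ} (hβ : 0 < β)
    (hβ1 : β < 1) (h : HasSharpExponents G β) {S : Finset G} (hS : IsSymmGenerating S) :
    hilbertCompressionExponent S = ENNReal.ofReal (1 / (2 * β)) := by
  obtain ⟨hF, T, hT, hne, hesc, hcomp⟩ := h
  rw [hilbertCompressionExponent, compressionExponents_eq hS hT]
  refine le_antisymm (iSup₂_le fun α hα => ENNReal.ofReal_le_ofReal ?_) (le_of_not_gt fun hlt => ?_)
  · have := hF.mul_le_one hT hne hesc hα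
    rw [le_div_iff₀ (by linarith)]
    linarith
  · obtain ⟨r, hr0, hr1, hr2⟩ := ENNReal.lt_iff_exists_real_btwn.1 hlt
    have hr : r < 1 / (2 * β) := (ENNReal.ofReal_lt_ofReal_iff (by positivity)).1 hr2
    -- Exponents are only provided from `1/2` on; as `β < 1`, raising `r` to `1/2` keeps it below
    -- `1/(2β)`.
    have hmem := hcomp (max r (1 / 2)) (le_max_right _ _) (max_lt hr (by
      rw [div_lt_div_iff₀ (by norm_num) (by linarith)]
      linarith))
    have h1 : ENNReal.ofReal r ≤ ENNReal.ofReal (max r (1 / 2)) :=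
      ENNReal.ofReal_le_ofReal (le_max_left _ _)
    have h2 := le_iSup₂ (f := fun α (_ : α ∈ compressionExponents T) => ENNReal.ofReal α) _ hmem
    exact absurd hr1 (not_lt.2 (h1.trans h2))

theorem hasSharpExponents_iteratedWreath (n : ℕ) :
    HasSharpExponents (iteratedWreath (n + 1)) (1 - (2 : ℝ) ^ (-((n + 1 : ℕ) : ℤ))) := by
  induction n with
  | zero =>
    have e : 1 - (2 : ℝ) ^ (-((0 + 1 : ℕ) : ℤ)) = 1 / 2 := by norm_num
    rw [e]
    exact hasSharpExponents_int
  | succ n ih =>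
    have hpos : 0 < 1 - (2 : ℝ) ^ (-((n + 1 : ℕ) : ℤ)) := by
      rw [sub_pos, zpow_neg, zpow_natCast]
      exact inv_lt_one_of_one_lt₀ (one_lt_pow₀ one_lt_two (by omega))
    have e : 1 - (2 : ℝ) ^ (-((n + 1 + 1 : ℕ) : ℤ)) =
        (1 + (1 - (2 : ℝ) ^ (-((n + 1 : ℕ) : ℤ)))) / 2 := by
      rw [zpow_neg, zpow_neg, zpow_natCast, zpow_natCast, pow_succ _ (n + 1), mul_inv]
      ring
    rw [e]
    exact ih.zwreath hpos

end Main

end HilbertCompression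

theorem mainTheorem3 (k : ℕ) (hk : 1 ≤ k) :
    (∃ S : Finset (HilbertCompression.iteratedWreath k),
      HilbertCompression.IsSymmGenerating S ∧
      HilbertCompression.HasEscapeEstimate S (1 - (2 : ℝ) ^ (-(k : ℤ)))) ∧
    (∀ S : Finset (HilbertCompression.iteratedWreath k),
      HilbertCompression.IsSymmGenerating S →
      HilbertCompression.hilbertCompressionExponent S ≤
        ENNReal.ofReal (1 / (2 - (2 : ℝ) ^ (1 - (k : ℤ)))) ∧
      HilbertCompression.hilbertCompressionExponent S =
        ENNReal.ofReal (1 / (2 - (2 : ℝ) ^ (1 - (k : ℤ))))) := by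
  obtain ⟨n, rfl⟩ : ∃ n, k = n + 1 := ⟨k - 1, by omega⟩
  have h := HilbertCompression.hasSharpExponents_iteratedWreath n
  refine ⟨?_, fun S hS => ?_⟩
  · obtain ⟨-, S, hS, -, hesc, -⟩ := h
    exact ⟨S, hS, hesc⟩
  · have hlt : (2 : ℝ) ^ (-((n + 1 : ℕ) : ℤ)) < 1 := by
      rw [zpow_neg, zpow_natCast]
      exact inv_lt_one_of_one_lt₀ (one_lt_pow₀ one_lt_two (by omega))
    have hpos : (0 : ℝ) < (2 : ℝ) ^ (-((n + 1 : ℕ) : ℤ)) := by positivity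
    have e := h.hilbertCompressionExponent_eq (by linarith) (by linarith) hS
    have e2 : 2 * (1 - (2 : ℝ) ^ (-((n + 1 : ℕ) : ℤ))) =
        2 - (2 : ℝ) ^ (1 - ((n + 1 : ℕ) : ℤ)) := by
      rw [sub_eq_add_neg 1 ((n + 1 : ℕ) : ℤ), zpow_add₀ two_ne_zero, zpow_one]
      ring
    rw [e2] at e
    exact ⟨e.le, e⟩
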